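/- \textbf{Leapers and frames.} Squares of the infinite chessboard are identified with integer points. For integers $0<p<q$, a $(p,q)$-leaper moves by the translations $(\pm p,\pm q)$, $(\pm q,\pm p)$; it is skew basic if moreover $p+q$ is odd and $\gcd(p,q)=1$. All boards and frames below are centred at the origin. For $0<m<n$ with $m+n$ odd, the $(m,n)$-frame $F$ is the $(m+n)\times(m+n)$ chessboard without its central $(n-m)\times(n-m)$ hole; the lines extending the sides of the hole cut it into eight rectangular sections $F_{E},F_{NE},F_{N},\dots,F_{SE}$. Its shell is empty if $3m<n$; otherwise it is the union of eight squares of side $\min(n-m,3m-n)$ centred at $(\pm(n-m),0)$, $(0,\pm(n-m))$, $(\pm m,\pm m)$. A shell cycle of $F$ is a cycle of the $(m,n)$-leaper within the shell. \textbf{Liftings.} $f$, $g$, $h$ lift an $(m,n)$-frame $F$ to an $(m,2m+n)$-, $(n,2n-m)$-, $(n,m+2n)$-frame $H$ respectively. With $u_i\in\{-1,0,1\}^2\setminus\{0\}$ the vector pointing in direction $i\in\{E,NE,\dots,SE\}$, put $v_i=a\,u_i$ for $i\in\{E,N,W,S\}$ and $v_i=b\,u_i$ for the other four $i$, where $(a,b)=(m+n,m)$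 for $f$, $(n-m,n)$ for $g$, $(m+n,n)$ for $h$. A set $S$ of squares of $F$ is lifted to $\bigcup_i (S+v_i)\cap H_i$. A cycle $a^{E}a^{NE}\cdots a^{SE}$ which is the concatenation of eight disjoint nonempty paths $a^i$ within the sections $F_i$ is \emph{proper} if, for each $i$, the $(m,n)$-leaper translation that maps $F_i\cup F_{i+1}$ onto $F_{-(i+1)}\cup F_{-i}$ maps the path $a^ia^{i+1}$ onto $-a^{-(i+1)}{-a^{-i}}$; here $i+1$ is the next direction counterclockwise, $-i$ the opposite one, and $-w$ the reversed path. Such a cycle is lifted to $b^{E}b^{NE}\cdots b^{SE}$, where, up to quarter-turn symmetry, for $f$: $b^{E}={-a^{SW}}{-a^{W}}{-a^{NW}}+v_E$ and $b^{NE}=a^{NE}+v_{NE}$; for $g$: $b^{E}=a^{E}+v_E$ and $b^{NE}={-a^{S}}{-a^{SW}}{-a^{W}}+v_{NE}$; for $h$: $b^{E}={-a^{S}}{-a^{SW}}{-a^{W}}{-a^{NW}}{-a^{N}}+v_E$ and $b^{NE}=a^{E}a^{NE}a^{N}+v_{NE}$. To lift by a string $e=e_1e_2\cdots e_l$ over $\{\mathtt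 f,\mathtt g,\mathtt h\}$ is to lift successively by $e_l,e_{l-1},\dots,e_1$. The descent of a skew basic $(p,q)$-leaper is the string that lifts the $(1,2)$-frame to the $(p,q)$-frame. \textbf{Cycles of given descent.} Let $C$ be a cycle of a skew basic $(p,q)$-leaper $L$ within the $(p+q)\times(p+q)$ chessboard. If the descent of $L$ is a concatenation $e\,e^*$ and the square set of $C$ is the lift by $e$ of the square set of a shell cycle $C_0$ of the frame obtained from the $(1,2)$-frame by lifting by $e^*$, then $C$ has descent $e$. Suppose moreover that $e^*=o\,e^{**}$ with $o\in\{\mathtt g,\mathtt h\}$, and let $e^{**}$ be the descent of the $(r,s)$-leaper $M$. Then the lift by $e$ of a proper cycle of $M$ over the squares of $C_0$ is a canonical second leaper cycle over the squares of $C$, of descent $e$ and origin $o$. \textbf{Direction graphs.} Let $A_1,\dots,A_8$ be the matrices $$\begin{pmatrix}0&1\\1&0\end{pmatrix},\begin{pmatrix}1&0\\0&1\end{pmatrix},\begin{pmatrix}-1&0\\0&1\end{pmatrix},\begin{pmatrix}0&-1\\1&0\end{pmatrix},\begin{pmatrix}0&-1\\-1&0\end{pmatrix},\begin{pmatrix}-1&0\\0&-1\end{pmatrix},\begin{pmatrix}1&0\\0&-1\end{pmatrix},\begin{pmatrix}0&1\\-1&0\end{pmatrix}.$$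 A move $v$ of a $(p,q)$-leaper with $0<p<q$ has direction $i\in\{1,\dots,8\}$ if $v^T=A_i\binom pq$. A direction graph is a symmetric directed graph whose arcs are labelled by $1,\dots,8$ so that the matrices $A_i$ of the labels sum to zero over every simple directed cycle (including those of length two). It is extracted from a cycle of a leaper if its vertices correspond one-to-one to the squares of the cycle so that an arc labelled $i$ leads from $x$ to $y$ if and only if a move of direction $i$ of the cycle leads from the square of $x$ to that of $y$. Two direction graphs are equivalent if there are a permutation $\pi$ of $\{1,\dots,8\}$ and real $2\times2$ matrices $P,Q$ with $A_{\pi(i)}=PA_iQ$ for all $i$ such that replacing every label $i$ of the first graph by $\pi(i)$ gives, up to renaming of vertices, the second. The fundamental direction cycle $\Phi(e)$ is the direction graph extracted from a cycle of descent $e$ of a skew basic $(p,q)$-leaper within the $(p+q)\times(p+q)$ chessboard; the second fundamental direction cycle $\Phi^{\mathrm{II}}_o(e)$, $o\in\{\mathtt g,\mathtt h\}$, is the one extracted from a canonical second leaper cycle of descent $e$ and origin $o$. \textbf{Theorem.} The flip of a string $e_1e_2\cdots e_l$ over $\{\mathtt f,\mathtt g,\mathtt h\}$ is $\overline{e_l}\,\overline{e_{l-1}}\cdots\overline{e_1}$,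 where $\overline{\mathtt f}=\mathtt g$, $\overline{\mathtt g}=\mathtt f$, $\overline{\mathtt h}=\mathtt h$. Let the strings $e'$ and $e''$ be flips of each other. Then $\Phi(e')$, $\Phi^{\mathrm{II}}_{\mathtt g}(e'')$ and $\Phi^{\mathrm{II}}_{\mathtt h}(e'')$ exist, and these three direction graphs are pairwise equivalent, whichever cycles of the given descents and origins they are extracted from. -/

import Mathlib

namespace Leaper

/-! ## Squares, leapers, leaper graphs

A square is identified with its centre, an integer point.  All leapers of interest satisfy
`p + q` odd, so the `(p + q) × (p + q)` chessboard can be centred at the square `(0, 0)`. -/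

/-- A unit square of the infinite chessboard, given by its centre. -/
abbrev Square := ℤ × ℤ

/-- `v` is one of the translations `(±p, ±q)`, `(±q, ±p)`. -/
def IsMove (p q : ℤ) (v : Square) : Prop :=
  (|v.1| = p ∧ |v.2| = q) ∨ (|v.1| = q ∧ |v.2| = p)

/-- The leaper graph of the `(p, q)`-leaper over the infinite chessboard. -/
def leaperGraph (p q : ℤ) : SimpleGraph Square where
  Adj a b := a ≠ b ∧ IsMove p q (b - a)
  symm := ⟨by
    rintro a b ⟨h, hm⟩
    refine ⟨h.symm, ?_⟩
    have e : a - b = -(b - a) := by abel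
    rw [e]
    simpa only [IsMove, Prod.fst_neg, Prod.snd_neg, abs_neg] using hm⟩
  loopless := ⟨fun _ h => h.1 rfl⟩

/-- The `(p, q)`-leaper is skew and basic, its proportions being listed in increasing order. -/
structure IsSkewBasic (p q : ℤ) : Prop where
  pos : 0 < p
  lt : p < q
  odd : Odd (p + q)
  coprime : IsCoprime p q

/-- A cycle of the `(p, q)`-leaper, as a subgraph of its leaper graph. -/
def IsCycle {p q : ℤ} (C : (leaperGraph p q).Subgraph) : Prop :=
  ∃ (a : Square) (w : (leaperGraph p q).Walk a a), w.IsCycle ∧ w.toSubgraph = C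

/-- `C` is the cycle that visits the squares of the list `l` in this cyclic order, each once. -/
def IsCycleThrough {p q : ℤ} (l : List Square) (C : (leaperGraph p q).Subgraph) : Prop :=
  ∃ (a : Square) (w : (leaperGraph p q).Walk a a),
    w.IsCycle ∧ w.support.dropLast = l ∧ w.toSubgraph = C

/-! ## Frames, sections, shells

The eight compass directions `E, NE, N, NW, W, SW, S, SE` are `0, 1, …, 7 : Fin 8`, with
cyclic addition; the direction opposite `i` is `i + 4`.  Sides are even, corners are odd.
An `(m, n)`-frame centred at the origin is given by the pair `F = (m, n)`. -/

/-- The sign pattern of a compass direction. -/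
def compass : Fin 8 → Square :=
  ![(1, 0), (1, 1), (0, 1), (-1, 1), (-1, 0), (-1, -1), (0, -1), (1, -1)]

/-- The `(m + n) × (m + n)` chessboard centred at the origin. -/
def board (F : ℤ × ℤ) : Set Square :=
  {s | |2 * s.1| < F.1 + F.2 ∧ |2 * s.2| < F.1 + F.2}

/-- For `c = 0`, the coordinate `x` lies in the central band, of width `n - m`; for `c = ±1`, it
lies in the outer band, of width `m`, on the side of sign `c`. -/
def InBand (F : ℤ × ℤ) (c x : ℤ) : Prop :=
  if c = 0 then |2 * x| < F.2 - F.1 else F.2 - F.1 < 2 * (c * x) ∧ 2 * (c * x) < F.1 + F.2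

/-- The section `F_i` of the frame `F`: the part of the board outside the central hole is cut
into eight rectangles by the lines that extend the sides of the hole. -/
def frameSection (F : ℤ × ℤ) (i : Fin 8) : Set Square :=
  {s | InBand F (compass i).1 s.1 ∧ InBand F (compass i).2 s.2}

/-- The side of the eight square subboards that form the shell: `n - m` if `2m ≥ n`, and
`3m - n` if `2m ≤ n`. -/
def shellSize (F : ℤ × ℤ) : ℤ :=
  if F.2 ≤ 2 * F.1 then F.2 - F.1 else 3 * F.1 - F.2

/-- The shell of the frame `F = (m, n)`: the squares within the eight square subboards of side
`shellSize F` whose centres are `(±(n - m), 0)`, `(0, ±(n - m))` and `(±m, ±m)`.  If `2m ≥ n`,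
these are the subboards of side `n - m` in the four corners of `F` and those adjacent by side to
the hole.  If `2m ≤ n ≤ 3m`, they are the subboards of side `3m - n` in the middles of the outer
sides of `F` and those adjacent by corner to the hole.  (For `3m < n` the set is empty.) -/
def shell (F : ℤ × ℤ) : Set Square :=
  {s | ∃ i : Fin 8,
    let c : ℤ := if i.val % 2 = 0 then F.2 - F.1 else F.1
    |2 * (s.1 - c * (compass i).1)| < shellSize F ∧ |2 * (s.2 - c * (compass i).2)| < shellSize F}

/-- A shell cycle: a cycle of the `(m, n)`-leaper within the shell of the `(m, n)`-frame. -/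
def IsShellCycle (F : ℤ × ℤ) (C : (leaperGraph F.1 F.2).Subgraph) : Prop :=
  IsCycle C ∧ C.verts ⊆ shell F

/-! ## Lifting transformations and descents -/

/-- The three characters `f`, `g`, `h`. -/
inductive Letter
  | f
  | g
  | h

/-- The proportions of the frame to which a lifting transformation lifts an `(m, n)`-frame. -/
def liftFrame : Letter → ℤ × ℤ → ℤ × ℤ
  | .f, F => (F.1, 2 * F.1 + F.2)
  | .g, F => (F.2, 2 * F.2 - F.1)
  | .h, F => (F.2, F.1 + 2 * F.2)

/-- The lengths of the coordinates of the lifting translations in the side (first component) and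
in the corner (second component) directions. -/
def liftLengths : Letter → ℤ × ℤ → ℤ × ℤ
  | .f, F => (F.1 + F.2, F.1)
  | .g, F => (F.2 - F.1, F.2)
  | .h, F => (F.1 + F.2, F.2)

/-- The `f`-, `g`- or `h`-translation that points in direction `i`. -/
def liftVector (t : Letter) (F : ℤ × ℤ) (i : Fin 8) : Square :=
  (if i.val % 2 = 0 then (liftLengths t F).1 else (liftLengths t F).2) • compass i

/-- The lifting transformations on sets of squares of the frame `F`: the union over all
directions `i` of `(S + v_i) ∩ H_i`, where `H` is the larger frame. -/
def liftSet (t : Letter) (F : ℤ × ℤ) (S : Set Square) : Set Square :=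
  ⋃ i : Fin 8, ((fun s => s + liftVector t F i) '' S) ∩ frameSection (liftFrame t F) i

/-- Lift the frame `F` successively by `e_l, …, e_1`, where `e = e_1 … e_l`. -/
def liftFrameSeq (e : List Letter) (F : ℤ × ℤ) : ℤ × ℤ := e.foldr liftFrame F

/-- Lift the set `S` of squares of the frame `F` successively by `e_l, …, e_1`. -/
def liftSetSeq : List Letter → ℤ × ℤ → Set Square → Set Square
  | [], _, S => S
  | t :: e, F, S => liftSet t (liftFrameSeq e F) (liftSetSeq e F S)

/-- `e` is the descent of the `(p, q)`-leaper: it lifts a `(1, 2)`-frame to a `(p, q)`-frame. -/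
def IsLeaperDescent (e : List Letter) (p q : ℤ) : Prop := liftFrameSeq e (1, 2) = (p, q)

/-- `C` is a cycle of the skew basic `(p, q)`-leaper within a `(p + q) × (p + q)` chessboard, the
prefix `e` of the descent `e ++ rest` of the leaper, and `C` is obtained from the shell cycle `C₀`
by successive lifting transformations of types `e_l, …, e_1`. -/
structure IsCycleFromShell (e rest : List Letter) (p q : ℤ) (C : (leaperGraph p q).Subgraph)
    (C₀ : (leaperGraph (liftFrameSeq rest (1, 2)).1 (liftFrameSeq rest (1, 2)).2).Subgraph) :
    Prop where
  skewBasic : IsSkewBasic p q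
  leaperDescent : IsLeaperDescent (e ++ rest) p q
  cycle : IsCycle C
  onBoard : C.verts ⊆ board (p, q)
  shellCycle : IsShellCycle (liftFrameSeq rest (1, 2)) C₀
  lift : C.verts = liftSetSeq e (liftFrameSeq rest (1, 2)) C₀.verts

/-- `C` is a cycle of descent `e` of a skew basic `(p, q)`-leaper within a `(p + q) × (p + q)`
chessboard. -/
def IsCycleOfDescent (e : List Letter) (p q : ℤ) (C : (leaperGraph p q).Subgraph) : Prop :=
  ∃ rest C₀, IsCycleFromShell e rest p q C C₀

/-! ## Proper cycles and canonical second leaper cycles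

A cycle that is the concatenation of eight paths, one in each section of a frame, is given by
the family `a` of these paths, as lists of squares. -/

/-- The concatenation `a^E a^NE … a^SE`. -/
def concatPaths (a : Fin 8 → List Square) : List Square := (List.ofFn a).flatten

/-- The `(m, n)`-leaper translation that maps `F_i ∪ F_{i+1}` onto `F_{-(i+1)} ∪ F_{-i}`. -/
def properVector (F : ℤ × ℤ) : Fin 8 → Square :=
  ![(-F.2, -F.1), (-F.1, -F.2), (F.1, -F.2), (F.2, -F.1),
    (F.2, F.1), (F.1, F.2), (-F.1, F.2), (-F.2, F.1)]

/-- `D = a^E a^NE … a^SE` is a proper cycle of the `(r, s)`-leaper within the frame `F`. -/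
structure IsProperCycle (F : ℤ × ℤ) {r s : ℤ} (a : Fin 8 → List Square)
    (D : (leaperGraph r s).Subgraph) : Prop where
  nonempty : ∀ i, a i ≠ []
  within : ∀ i, ∀ x ∈ a i, x ∈ frameSection F i
  cycle : IsCycleThrough (concatPaths a) D
  proper : ∀ i, (a i ++ a (i + 1)).map (fun x => x + properVector F i) =
    (a (i + 5)).reverse ++ (a (i + 4)).reverse

/-- The paths, before translation by `v_i`, that form the section `b^i` of the lift of the proper
cycle `a^E … a^SE`.  For `f` and `i = E`, this is `-a^SW -a^W -a^NW`; for `f` and `i = NE`, it is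
`a^NE`; for `g` and `i = E`, it is `a^E`; for `g` and `i = NE`, it is `-a^S -a^SW -a^W`; for `h` and
`i = E`, it is `-a^S -a^SW -a^W -a^NW -a^N`; for `h` and `i = NE`, it is `a^E a^NE a^N`.  (In each
case, these are the parts of the cycle whose translates by `v_i` lie in the section `H_i`.) -/
def liftPathsAux (t : Letter) (a : Fin 8 → List Square) (i : Fin 8) : List Square :=
  match t with
  | .f => if i.val % 2 = 0 then (a (i + 3) ++ a (i + 4) ++ a (i + 5)).reverse else a i
  | .g => if i.val % 2 = 0 then a i else (a (i + 3) ++ a (i + 4) ++ a (i + 5)).reverse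
  | .h => if i.val % 2 = 0 then
      (a (i + 2) ++ a (i + 3) ++ a (i + 4) ++ a (i + 5) ++ a (i + 6)).reverse
    else a (i + 7) ++ a i ++ a (i + 1)

/-- The lift of a proper cycle within the frame `F`, as a family of eight paths. -/
def liftPaths (t : Letter) (F : ℤ × ℤ) (a : Fin 8 → List Square) (i : Fin 8) : List Square :=
  (liftPathsAux t a i).map (fun x => x + liftVector t F i)

/-- Lift a proper cycle within the frame `F` successively by `e_l, …, e_1`. -/
def liftPathsSeq : List Letter → ℤ × ℤ → (Fin 8 → List Square) → (Fin 8 → List Square)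
  | [], _, a => a
  | t :: e, F, a => liftPaths t (liftFrameSeq e F) (liftPathsSeq e F a)

/-- `D` is a canonical second leaper cycle, of descent `e` and origin `o`, of a skew basic
`(r, s)`-leaper over the squares of the cycle `C` of a skew basic `(p, q)`-leaper within a
`(p + q) × (p + q)` chessboard.  That is, for some word `rest`: the `(p, q)`-leaper has descent
`e ++ o :: rest`; the word `rest` lifts a `(1, 2)`-frame to an `(r, s)`-frame, which `o` lifts to a
frame `F`; the cycle `C` is the lift by `e` of a cycle `C₀` within the shell of `F`; and `D` is the
lift by `e` of a proper cycle `D₀` of the `(r, s)`-leaper over the squares of `C₀`. -/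
def IsCanonicalSecondCycle (e : List Letter) (o : Letter) {p q r s : ℤ}
    (C : (leaperGraph p q).Subgraph) (D : (leaperGraph r s).Subgraph) : Prop :=
  ∃ rest C₀, IsCycleFromShell e (o :: rest) p q C C₀ ∧
    IsSkewBasic r s ∧ liftFrameSeq rest (1, 2) = (r, s) ∧
    ∃ (a : Fin 8 → List Square) (D₀ : (leaperGraph r s).Subgraph),
      IsProperCycle (liftFrameSeq (o :: rest) (1, 2)) a D₀ ∧ D₀.verts = C₀.verts ∧
      IsCycleThrough (concatPaths (liftPathsSeq e (liftFrameSeq (o :: rest) (1, 2)) a)) D ∧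
      D.verts = C.verts

/-! ## Skew directions and direction graphs

The eight skew directions, labelled `1, …, 8` counterclockwise from east-northeast, are
`0, …, 7 : Fin 8`: the direction labelled `k` is `k - 1`. -/

/-- The direction matrices `A_1, …, A_8`. -/
def dirMatrix : Fin 8 → Matrix (Fin 2) (Fin 2) ℤ :=
  ![!![0, 1; 1, 0], !![1, 0; 0, 1], !![-1, 0; 0, 1], !![0, -1; 1, 0],
    !![0, -1; -1, 0], !![-1, 0; 0, -1], !![1, 0; 0, -1], !![0, 1; -1, 0]]

/-- The translation `v` is the move of direction `i` of the `(p, q)`-leaper, `p < q`: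
`vᵀ = A_i (p, q)ᵀ`. -/
def IsMoveOfDirection (p q : ℤ) (i : Fin 8) (v : Square) : Prop :=
  ![v.1, v.2] = (dirMatrix i).mulVec ![p, q]

/-- A direction graph on the vertex set `V`: `Arc x y i` says that there is an arc from `x` to `y`
labelled `i`.  The graph is symmetric, and the direction matrices sum to zero over every simple
directed cycle, those of length one and two included (so there are no loops, no two arcs
from `x` to `y` have different labels, and opposite arcs have opposite labels). -/
structure DirectionGraph (V : Type*) where
  Arc : V → V → Fin 8 → Prop
  symm : ∀ x y i, Arc x y i → ∃ j, Arc y x j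
  cycle_sum : ∀ (n : ℕ) (x : Fin (n + 1) → V) (l : Fin (n + 1) → Fin 8), Function.Injective x →
    (∀ k, Arc (x k) (x (k + 1)) (l k)) → ∑ k, dirMatrix (l k) = 0

/-- The direction graph `Φ` is extracted from the graph `G` of moves of the `(p, q)`-leaper. -/
def IsExtractedFrom {V : Type*} (Φ : DirectionGraph V) {p q : ℤ}
    (G : (leaperGraph p q).Subgraph) : Prop :=
  ∃ σ : G.verts ≃ V, ∀ (a b : G.verts) (i : Fin 8),
    (G.Adj a b ∧ IsMoveOfDirection p q i ((b : Square) - a)) ↔ Φ.Arc (σ a) (σ b) i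

/-- The permutation `π` of the eight skew directions is an equivalence permutation. -/
def IsEquivalencePerm (π : Equiv.Perm (Fin 8)) : Prop :=
  ∃ P Q : Matrix (Fin 2) (Fin 2) ℝ, ∀ i,
    (dirMatrix (π i)).map (Int.cast : ℤ → ℝ) = P * (dirMatrix i).map (Int.cast : ℤ → ℝ) * Q

/-- `Φ₁` and `Φ₂` are equivalent: relabelling the arcs of `Φ₁` by some equivalence permutation
gives `Φ₂`, up to renaming of the vertices. -/
def DirectionGraph.Equivalent {V W : Type*} (Φ₁ : DirectionGraph V) (Φ₂ : DirectionGraph W) :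
    Prop :=
  ∃ π : Equiv.Perm (Fin 8), IsEquivalencePerm π ∧
    ∃ τ : V ≃ W, ∀ x y i, Φ₁.Arc x y i ↔ Φ₂.Arc (τ x) (τ y) (π i)

/-- `Φ` is the fundamental direction cycle of descent `e`. -/
def IsFundamental {V : Type*} (e : List Letter) (Φ : DirectionGraph V) : Prop :=
  ∃ (p q : ℤ) (C : (leaperGraph p q).Subgraph), IsCycleOfDescent e p q C ∧ IsExtractedFrom Φ C

/-- `Φ` is the second fundamental direction cycle of descent `e` and origin `o`. -/
def IsSecondFundamental {V : Type*} (e : List Letter) (o : Letter) (Φ : DirectionGraph V) : Prop :=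
  ∃ (p q r s : ℤ) (C : (leaperGraph p q).Subgraph) (D : (leaperGraph r s).Subgraph),
    IsCanonicalSecondCycle e o C D ∧ IsExtractedFrom Φ D

/-! ## Flips -/

/-- The involution that swaps `f` and `g` and fixes `h`. -/
def Letter.bar : Letter → Letter
  | .f => .g
  | .g => .f
  | .h => .h

/-- The flip of a string of letters: reverse it and bar every letter. -/
def flip (e : List Letter) : List Letter := (e.map Letter.bar).reverse

end Leaper

/-!
In the board of the `(p, q)`-leaper every square has at most two neighbours, so a cycle there is
determined by any one of its squares. Hence a shell cycle is a translate of the cycle through the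
centres of the eight subboards of the shell, and the cyclic word of move directions of a cycle of
descent `e`, or of a canonical second leaper cycle, follows from `e` by local rules: lifting
replaces every vertex of the first cycle by a path that depends on the section and the orientation
of the vertex, and rearranges the eight paths of the second cycle.

Map the directions to the free group of rank four, opposite directions to mutually inverse elements.
The last letter of the flip of `e` is the bar of the first letter of `e`, so the word of the second
cycle grows on the outside while that of the first cycle grows by substitution on the inside;
induction on `e` shows that, after a fixed relabelling, the two words give conjugate elements. A
cycle never turns back, so both words are cyclically reduced, and are therefore rotations of one
another. The relabelling is induced by `X ↦ P X Q` for suitable matrices `P` and `Q`, so the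
direction graphs are equivalent.
-/

namespace Leaper

open scoped Fin.CommRing

/-! ### Words along a lifted cycle -/

section FreeGroup

open FreeGroup

variable {α : Type*} {L L₁ L₂ c : List (α × Bool)} {x : α × Bool}

theorem isCyclicallyReduced_cons_iff_isReduced :
    IsCyclicallyReduced (x :: L) ↔ FreeGroup.IsReduced (x :: L ++ [x]) := by
  unfold IsCyclicallyReduced FreeGroup.IsReduced
  rw [List.isChain_append]
  simp

theorem isCyclicallyReduced_concat_iff_isReduced :
    IsCyclicallyReduced (L ++ [x]) ↔ FreeGroup.IsReduced (x :: L ++ [x]) := by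
  unfold IsCyclicallyReduced FreeGroup.IsReduced
  rw [List.cons_append, List.isChain_cons]
  simp only [List.getLast?_concat, Option.mem_def, Option.some.injEq, forall_eq']
  grind

theorem isCyclicallyReduced_cons_iff_concat :
    IsCyclicallyReduced (x :: L) ↔ IsCyclicallyReduced (L ++ [x]) :=
  isCyclicallyReduced_cons_iff_isReduced.trans isCyclicallyReduced_concat_iff_isReduced.symm

theorem injOn_mk_isReduced : Set.InjOn (mk (α := α)) {L | FreeGroup.IsReduced L} := by
  classical
  intro L₁ h₁ L₂ h₂ h
  rw [← IsReduced.reduce_eq h₁, ← IsReduced.reduce_eq h₂, reduce.sound h]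

theorem isReduced_invRev (h : FreeGroup.IsReduced L) : FreeGroup.IsReduced (invRev L) := by
  classical
  rw [isReduced_iff_reduce_eq, reduce_invRev, h.reduce_eq]

theorem isReduced_conj (hc : FreeGroup.IsReduced (c ++ [x])) (hL : FreeGroup.IsReduced L)
    (hne : L ≠ []) (head : L.head? ≠ some (x.1, !x.2)) (last : L.getLast? ≠ some x) :
    FreeGroup.IsReduced (c ++ [x] ++ (L ++ invRev (c ++ [x]))) := by
  refine List.isChain_append.2
    ⟨hc, List.isChain_append.2 ⟨hL, isReduced_invRev hc, fun z hz y hy hzy => ?_⟩, ?_⟩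
  · obtain rfl : (x.1, !x.2) = y := by simpa [invRev] using hy
    exact Bool.eq_not.2 fun h => last (Option.mem_def.1 hz ▸ congrArg some (Prod.ext hzy h))
  · intro y hy z hz hyz
    obtain rfl : x = y := by simpa using hy
    rw [List.head?_append_of_ne_nil _ hne] at hz
    refine Bool.not_eq_not.1 fun h => head ?_
    exact Option.mem_def.1 hz ▸ congrArg some (Prod.ext hyz.symm (Bool.eq_not.2 (by simp [h])))

theorem not_isCyclicallyReduced_conj (hc : c ≠ []) :
    ¬ IsCyclicallyReduced (c ++ (L ++ invRev c)) := by
  obtain ⟨d, D, rfl⟩ := List.exists_cons_of_ne_nil hc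
  intro h
  have hlast : d :: D ++ (L ++ invRev (d :: D)) = (d :: (D ++ L ++ invRev D)) ++ [(d.1, !d.2)] := by
    simp [invRev]
  simpa using h.2 (d.1, !d.2) (by rw [hlast, List.getLast?_concat]; rfl) d (by simp)

theorem isRotated_of_mk_conj_eq (hc : FreeGroup.IsReduced c) (h₁ : IsCyclicallyReduced L₁)
    (h₂ : IsCyclicallyReduced L₂) (h : mk c * mk L₁ * (mk c)⁻¹ = mk L₂) : L₁ ~r L₂ := by
  induction c using List.reverseRecOn generalizing L₁ with
  | nil =>
    rw [injOn_mk_isReduced h₁.1 h₂.1 (by simpa [← one_eq_mk] using h)]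
  | append_singleton c x ih =>
    have hc' : FreeGroup.IsReduced c := List.IsChain.left_of_append hc
    have mk_cons : ∀ y (T : List (α × Bool)), mk (y :: T) = mk [y] * mk T := by simp [mul_mk]
    by_cases head : L₁.head? = some (x.1, !x.2)
    · obtain ⟨T, rfl⟩ := List.head?_eq_some_iff.1 head
      have mk_inv : mk [(x.1, !x.2)] = (mk [x])⁻¹ := by simp [inv_mk, invRev]
      refine .trans ⟨1, by simp⟩ (ih hc' (isCyclicallyReduced_cons_iff_concat.1 h₁) ?_)
      rw [← h, mk_cons, ← mul_mk, ← mul_mk, mk_inv]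
      group
    by_cases last : L₁.getLast? = some x
    · obtain ⟨T, rfl⟩ := List.getLast?_eq_some_iff.1 last
      refine .trans (.symm ⟨1, by simp⟩) (ih hc' (isCyclicallyReduced_cons_iff_concat.2 h₁) ?_)
      rw [← h, mk_cons, ← mul_mk, ← mul_mk]
      group
    rcases eq_or_ne L₁ [] with rfl | hne
    · rw [injOn_mk_isReduced (x₁ := []) (by simp) h₂.1
        (by rw [← h, ← one_eq_mk, mul_one, mul_inv_cancel])]
    · have heq := injOn_mk_isReduced (isReduced_conj hc h₁.1 hne head last) h₂.1
        (by simp only [← h, inv_mk, mul_mk, List.append_assoc])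
      exact absurd (heq ▸ h₂) (not_isCyclicallyReduced_conj (by simp))

theorem isRotated_of_isConj_mk (h₁ : IsCyclicallyReduced L₁) (h₂ : IsCyclicallyReduced L₂)
    (h : IsConj (mk L₁) (mk L₂)) : L₁ ~r L₂ := by
  classical
  obtain ⟨c, hc⟩ := isConj_iff.1 h
  exact isRotated_of_mk_conj_eq isReduced_toWord h₁ h₂ (by rwa [mk_toWord])

end FreeGroup

section Letters

/-- In the lift by `t`, the path in section `i` is the union of consecutive paths of the original
cycle: of those in the `2 * t.radius + 1` sections around `i`, or, where the path is reversed, of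
those in the `2 * t.radius + 3` sections around `i + 4`. -/
def Letter.radius : Letter → ℕ
  | .f => 0
  | .g => 0
  | .h => 1

/-- The lift by `t` reverses the paths that it places in section `i`. -/
def Letter.Reverses : Letter → Fin 8 → Prop
  | .g, i => i.val % 2 = 1
  | _, i => i.val % 2 = 0

instance (t : Letter) : DecidablePred t.Reverses := fun i => by
  cases t <;> exact inferInstanceAs (Decidable (_ = _))

theorem Letter.reverses_add_one_iff (t : Letter) (i : Fin 8) :
    t.Reverses (i + 1) ↔ ¬ t.Reverses i := by
  cases t <;> revert i <;> decide

/-- The `n + 1` consecutive directions `k, …, k + n`. -/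
def arc : ℕ → Fin 8 → List (Fin 8)
  | 0, k => [k]
  | n + 1, k => k :: arc n (k + 1)

theorem arc_add (n : ℕ) (k c : Fin 8) : arc n (k + c) = (arc n k).map (· + c) := by
  induction n generalizing k with
  | zero => rfl
  | succ n ih => rw [arc, arc, List.map_cons, ← ih, add_right_comm]

/-- The `2 * r + 1` consecutive directions `k - r, …, k + r`. -/
def centredArc (r : ℕ) (k : Fin 8) : List (Fin 8) := arc (2 * r) (k - r)

theorem centredArc_add (r : ℕ) (k c : Fin 8) :
    centredArc r (k + c) = (centredArc r k).map (· + c) := by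
  rw [centredArc, centredArc, ← arc_add, add_sub_right_comm]

end Letters

section Gauge

variable {G : Type*} [Group G]

/-- Opposite directions have mutually inverse values. -/
def Antipodal (x : Fin 8 → G) : Prop := ∀ k, x (k + 4) = (x k)⁻¹

/-- The product `a k * x k * a (k + 1) * ⋯ * x (k + n - 1) * a (k + n)`, of blocks `a` separated by
junctions `x`. -/
def blockRun (a x : Fin 8 → G) : ℕ → Fin 8 → G
  | 0, k => a k
  | n + 1, k => a k * x k * blockRun a x n (k + 1)

theorem blockRun_succ' (a x : Fin 8 → G) (n : ℕ) (k : Fin 8) :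
    blockRun a x (n + 1) k = blockRun a x n k * x (k + n) * a (k + n + 1) := by
  induction n generalizing k with
  | zero => simp [blockRun]
  | succ n ih =>
    rw [blockRun, ih, blockRun]
    push_cast
    rw [show k + 1 + n = k + (n + 1) by ring]
    simp only [mul_assoc]

/-- The product of the `2 * r + 1` blocks around `k`, and of the junctions between them. -/
def centredRun (a x : Fin 8 → G) (r : ℕ) (k : Fin 8) : G := blockRun a x (2 * r) (k - r)

theorem centredRun_succ (a x : Fin 8 → G) (r : ℕ) (k : Fin 8) :
    centredRun a x (r + 1) k =
      a (k - r - 1) * x (k - r - 1) * centredRun a x r k * x (k + r) * a (k + r + 1) := by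
  rw [centredRun, mul_add_one, blockRun, blockRun_succ', centredRun]
  push_cast
  rw [show k - (r + 1) = k - r - 1 by ring, show k - r - 1 + 1 = k - (r : Fin 8) by ring,
    show k - r + 2 * r = k + (r : Fin 8) by ring]
  simp only [mul_assoc]

theorem centredRun_succ_left (a x : Fin 8 → G) (r : ℕ) (k : Fin 8) :
    centredRun a x (r + 1) k =
      a (k - r - 1) * x (k - r - 1) * (a (k - r) * x (k - r) * centredRun a x r (k + 1)) := by
  rw [centredRun, mul_add_one, blockRun, blockRun, centredRun]
  push_cast
  rw [show k - (r + 1) = k - r - 1 by ring, show k - r - 1 + 1 = k - (r : Fin 8) by ring,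
    show k - r + 1 = k + 1 - (r : Fin 8) by ring]

theorem centredRun_succ_right (a x : Fin 8 → G) (r : ℕ) (k : Fin 8) :
    centredRun a x (r + 1) k =
      centredRun a x r (k - 1) * x (k + r - 1) * a (k + r) * x (k + r) * a (k + r + 1) := by
  rw [centredRun, mul_add_one, blockRun_succ', blockRun_succ', centredRun]
  push_cast
  rw [show k - (r + 1) = k - 1 - r by ring, show k - 1 - r + 2 * r = k + r - (1 : Fin 8) by ring,
    show k - 1 - r + (2 * r + 1) = k + (r : Fin 8) by ring,
    show k + r - 1 + 1 = k + (r : Fin 8) by ring]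

/-- The blocks `A` and junctions `X` of one cyclic product are those of another, `a` and `x`, up to
factors `g` and `h` that make the two products conjugate by `g 0`. The relation `cross` between
these factors is the invariant that lets the comparison survive `Gauge.step`. -/
structure Gauge (A X a x g h : Fin 8 → G) : Prop where
  antipodal : Antipodal X
  antipodal' : Antipodal x
  block : ∀ k, A k = g k * a k * h k
  junction : ∀ k, X k = (h k)⁻¹ * x k * (g (k + 1))⁻¹
  cross : ∀ k, h k * g (k + 3) = (a k)⁻¹ * (a (k + 3))⁻¹

namespace Gauge

variable {A X a x g h : Fin 8 → G}

theorem apply_add_three (H : Gauge A X a x g h) (k : Fin 8) :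
    g (k + 3) = (h k)⁻¹ * (a k)⁻¹ * (a (k + 3))⁻¹ := by
  rw [mul_assoc, ← H.cross, inv_mul_cancel_left]

theorem inv_h (H : Gauge A X a x g h) (k : Fin 8) : (h k)⁻¹ = g (k + 3) * a (k + 3) * a k := by
  rw [H.apply_add_three]
  group

theorem blockRun (H : Gauge A X a x g h) (n : ℕ) (k : Fin 8) :
    blockRun A X n k = g k * blockRun a x n k * h (k + n) := by
  induction n generalizing k with
  | zero => simp [Leaper.blockRun, H.block]
  | succ n ih =>
    rw [Leaper.blockRun, Leaper.blockRun, ih, H.block, H.junction]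
    push_cast
    rw [show k + 1 + n = k + (n + 1) by ring]
    group

theorem centredRun (H : Gauge A X a x g h) (r : ℕ) (k : Fin 8) :
    centredRun A X r k = g (k - r) * centredRun a x r k * h (k + r) := by
  rw [Leaper.centredRun, Leaper.centredRun, H.blockRun]
  congr 2
  push_cast
  ring

theorem inv_centredRun_succ (H : Gauge A X a x g h) (r : ℕ) (k : Fin 8) :
    (Leaper.centredRun A X (r + 1) (k + 4))⁻¹ =
      g (k + r) * a (k + r) * x (k + r) * (Leaper.centredRun a x r (k + 4))⁻¹ *
        (x (k - r - 1) * a (k - r) * h (k - r)) := by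
  rw [H.centredRun, centredRun_succ]
  push_cast
  rw [show k + 4 - (r + 1) = k - r + (3 : Fin 8) by ring,
    show k + 4 + (r + 1) = k + r + (5 : Fin 8) by ring,
    show k + 4 - r - 1 = k - r + (3 : Fin 8) by ring,
    show k + 4 + r + 1 = k + r + (5 : Fin 8) by ring,
    show k + 4 + r = k + r + (4 : Fin 8) by ring, H.antipodal',
    show x (k - r + 3) = (x (k - r - 1))⁻¹ by rw [← H.antipodal']; congr 1; ring,
    mul_inv_rev, mul_inv_rev, H.inv_h, H.apply_add_three (k - r),
    show k + r + 5 + 3 = k + (r : Fin 8) by grind]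
  group

theorem step (H : Gauge A X a x g h) (r : ℕ) {P : Fin 8 → Prop} [DecidablePred P]
    (hP : ∀ k, P (k + 1) ↔ ¬ P k) :
    Gauge
      (fun k => if P k then (Leaper.centredRun A X (r + 1) (k + 4))⁻¹
        else Leaper.centredRun A X r k)
      (fun k => if P k then X (k - r) else X (k + r))
      (fun k => if P k then (Leaper.centredRun a x r (k + 4))⁻¹
        else Leaper.centredRun a x (r + 1) k)
      (fun k => if P k then x (k - r - 1) else x (k + r + 1))
      (fun k => if P k then g (k + r) * a (k + r) * x (k + r)
        else g (k - r) * (x (k - r - 1))⁻¹ * (a (k - r - 1))⁻¹)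
      (fun k => if P k then x (k - r - 1) * a (k - r) * h (k - r)
        else (a (k + r + 1))⁻¹ * (x (k + r))⁻¹ * h (k + r)) := by
  have hP3 : ∀ k, P (k + 3) ↔ ¬ P k := fun k => by
    rw [show k + 3 = k + 1 + 1 + 1 by ring, hP, hP, hP, not_not]
  have hP4 : ∀ k, P (k + 4) ↔ P k := fun k => by
    rw [show k + 4 = k + 3 + 1 by ring, hP, hP3, not_not]
  refine ⟨fun k => ?_, fun k => ?_, fun k => ?_, fun k => ?_, fun k => ?_⟩
  · by_cases hk : P k <;>
      simp only [hP4, hk, if_true, if_false, ← H.antipodal _] <;> congr 1 <;> ring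
  · by_cases hk : P k <;>
      simp only [hP4, hk, if_true, if_false, ← H.antipodal' _] <;> congr 1 <;> ring
  · by_cases hk : P k <;>
      simp only [hk, if_true, if_false]
    · exact H.inv_centredRun_succ r k
    · rw [H.centredRun, centredRun_succ]
      group
  · by_cases hk : P k <;>
      simp only [hP, hk, if_true, if_false, not_true, not_false_eq_true, H.junction]
    · rw [show k + 1 - r = k - r + (1 : Fin 8) by ring, add_sub_cancel_right]
      group
    · rw [show k + 1 + r = k + r + (1 : Fin 8) by ring]
      group
  · by_cases hk : P k <;> simp only [hP3, hk, if_true, if_false, not_true, not_false_eq_true]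
    · rw [centredRun_succ_left, show k + 3 + 1 = k + (4 : Fin 8) by ring,
        show k + 3 - r = k - r + (3 : Fin 8) by ring, H.apply_add_three,
        show x (k - r + 3) = (x (k - r - 1))⁻¹ by rw [← H.antipodal']; congr 1; ring]
      group
    · rw [centredRun_succ_right, show k + 3 + 4 = k - (1 : Fin 8) by grind,
        show k + 3 + r = k + r + (3 : Fin 8) by ring, H.apply_add_three,
        show x (k + r + 3) = (x (k + r - 1))⁻¹ by rw [← H.antipodal']; congr 1; ring]
      group

theorem prod_arc (H : Gauge A X a x g h) (n : ℕ) (k : Fin 8) :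
    ((arc n k).map fun j => A j * X j).prod =
      g k * ((arc n k).map fun j => a j * x j).prod * (g (k + n + 1))⁻¹ := by
  have step : ∀ k, A k * X k = g k * (a k * x k) * (g (k + 1))⁻¹ := fun k => by
    rw [H.block, H.junction]; group
  induction n generalizing k with
  | zero => simp [arc, step]
  | succ n ih =>
    rw [arc, List.map_cons, List.prod_cons, ih, step, List.map_cons, List.prod_cons]
    push_cast
    rw [show k + 1 + n + 1 = k + (n + 1) + (1 : Fin 8) by ring]
    group

end Gauge

theorem prod_arc (a x : Fin 8 → G) (n : ℕ) (k : Fin 8) :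
    ((arc n k).map fun j => a j * x j).prod = blockRun a x n k * x (k + n) := by
  induction n generalizing k with
  | zero => simp [arc, blockRun]
  | succ n ih =>
    rw [arc, List.map_cons, List.prod_cons, ih, blockRun]
    push_cast
    rw [show k + 1 + n = k + (n + 1) by ring]
    group

theorem prod_reverse_arc {a x : Fin 8 → G} (hx : Antipodal x) (n : ℕ) (k : Fin 8) :
    ((arc n k).reverse.map fun j => (a (j + 4))⁻¹ * x (j - 1)).prod =
      (blockRun a x n (k + 4))⁻¹ * x (k - 1) := by
  induction n generalizing k with
  | zero => simp [arc, blockRun]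
  | succ n ih =>
    rw [arc, List.reverse_cons, List.map_append, List.prod_append, ih, blockRun, hx,
      add_sub_cancel_right, show k + 1 + 4 = k + 4 + 1 by ring]
    simp only [List.map_cons, List.map_nil, List.prod_singleton]
    group

theorem prod_centredArc (a x : Fin 8 → G) (r : ℕ) (k : Fin 8) :
    ((centredArc r k).map fun j => a j * x j).prod = centredRun a x r k * x (k + r) := by
  rw [centredArc, prod_arc, centredRun]
  push_cast
  rw [show k - r + 2 * r = k + (r : Fin 8) by ring]

theorem prod_reverse_centredArc {a x : Fin 8 → G} (hx : Antipodal x) (r : ℕ) (k : Fin 8) :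
    ((centredArc r k).reverse.map fun j => (a (j + 4))⁻¹ * x (j - 1)).prod =
      (centredRun a x r (k + 4))⁻¹ * x (k - r - 1) := by
  rw [centredArc, prod_reverse_arc hx, centredRun, add_sub_right_comm]

end Gauge

section Words

/-- The directions of the moves of a path traversed backwards. -/
def reverseWord (w : List (Fin 8)) : List (Fin 8) := (w.map (· + 4)).reverse

/-- The word read along the sections `i, …, i + n`, if `U` gives the words read within the sections
and `X` the directions of the moves between consecutive sections. -/
def pathRun (U : Fin 8 → List (Fin 8)) (X : Fin 8 → Fin 8) : ℕ → Fin 8 → List (Fin 8)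
  | 0, i => U i
  | n + 1, i => U i ++ X i :: pathRun U X n (i + 1)

/-- The word read within section `i` of the lift by `t` of a proper cycle with words `U` within the
sections and directions `X` between them. -/
def nextWord (t : Letter) (U : Fin 8 → List (Fin 8)) (X : Fin 8 → Fin 8) (i : Fin 8) :
    List (Fin 8) :=
  if t.Reverses i then
    reverseWord (pathRun U X (2 * (t.radius + 1)) (i + 4 - (t.radius + 1 : ℕ)))
  else pathRun U X (2 * t.radius) (i - t.radius)

/-- The direction of the move from section `i` to section `i + 1` in the lift by `t` of a proper
cycle with directions `X` between its sections. -/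
def nextJunction (t : Letter) (X : Fin 8 → Fin 8) (i : Fin 8) : Fin 8 :=
  if t.Reverses i then X (i - t.radius) else X (i + t.radius)

/-- The direction of the move from section `i` to section `i + 1` in the lift by `e` of a proper
cycle with one square in each section, where this move has direction `i` before the lift. -/
def junctionLabel : List Letter → Fin 8 → Fin 8
  | [] => id
  | t :: e => nextJunction t (junctionLabel e)

/-- The word read within section `i` of the lift by `e` of a proper cycle with one square in each
section, with the convention of `junctionLabel` for the directions. -/
def pathWord : List Letter → Fin 8 → List (Fin 8)
  | [] => fun _ => []
  | t :: e => nextWord t (pathWord e) (junctionLabel e)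

/-- The cyclic word of directions of a canonical second leaper cycle of descent `e`, up to the
relabelling `originPerm`. -/
def secondWord (e : List Letter) : List (Fin 8) :=
  (List.ofFn fun i => pathWord e i ++ [junctionLabel e i]).flatten

/-- What lifting needs to know about a vertex of an oriented cycle: its section, and which of two
ways the cycle goes through it. -/
abbrev VertexType := Fin 8 × Bool

/-- The direction in which a cycle leaves a vertex of type `τ`. -/
def outDir (τ : VertexType) : Fin 8 := if τ.2 then τ.1 + 3 else τ.1 + 4

/-- The direction of the move by which a cycle arrives at a vertex of type `τ`. -/
def inDir (τ : VertexType) : Fin 8 := if τ.2 then τ.1 else τ.1 + 7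

/-- The types of the consecutive vertices to which a vertex of type `(i, true)` is lifted by `t`. -/
def liftTypePos (t : Letter) (i : Fin 8) : List VertexType :=
  match t with
  | .f => if i.val % 2 = 0 then [(i + 4, false)] else [(i + 5, true), (i, true), (i + 3, true)]
  | .g => if i.val % 2 = 0 then [(i + 5, true), (i, true), (i + 3, true)] else [(i + 4, false)]
  | .h => if i.val % 2 = 0 then
      [(i + 6, true), (i + 1, true), (i + 4, true), (i + 7, true), (i + 2, true)]
    else [(i + 3, false), (i, false), (i + 5, false)]

/-- The types of the consecutive vertices to which a vertex of type `τ` is lifted by `t`: flipping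
the orientation of a vertex reverses its lift. -/
def liftType (t : Letter) (τ : VertexType) : List VertexType :=
  if τ.2 then liftTypePos t τ.1
  else ((liftTypePos t τ.1).map fun σ => (σ.1, !σ.2)).reverse

/-- The types of the consecutive vertices to which a vertex of type `τ` is lifted by `e`. -/
def liftTypeSeq : List Letter → VertexType → List VertexType
  | [], τ => [τ]
  | t :: e, τ => (liftTypeSeq e τ).flatMap (liftType t)

/-- The type of the `k`-th vertex of a shell cycle; the cycle visits every third section. -/
def shellType (k : Fin 8) : VertexType := (3 * k + 3, true)

/-- The type of a vertex of a reversed shell cycle, numbered so that it is left in the direction in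
which `shellType (k - 1)` is. -/
def reversedShellType (k : Fin 8) : VertexType := (3 * k + 7, false)

/-- The types of the consecutive vertices of a cycle of descent `e`. -/
def firstTypes (e : List Letter) : List VertexType :=
  ((arc 7 7).map shellType).flatMap (liftTypeSeq e)

/-- The cyclic word of directions of a cycle of descent `e`. -/
def firstWord (e : List Letter) : List (Fin 8) := (firstTypes e).map outDir

/-- The relabelling of directions that numbers the moves of a shell cycle in their cyclic order. -/
def starPerm : Equiv.Perm (Fin 8) :=
  Function.Involutive.toPerm (fun d => 3 * d + 6) fun d => by revert d; decide

theorem starPerm_outDir_shellType (k : Fin 8) : starPerm (outDir (shellType k)) = k := by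
  revert k; decide

theorem starPerm_outDir_reversedShellType (k : Fin 8) :
    starPerm (outDir (reversedShellType k)) = k - 1 := by
  revert k; decide

theorem liftTypeSeq_append (e : List Letter) (t : Letter) (τ : VertexType) :
    liftTypeSeq (e ++ [t]) τ = (liftType t τ).flatMap (liftTypeSeq e) := by
  induction e with
  | nil => simp [liftTypeSeq]
  | cons s e ih => simp only [List.cons_append, liftTypeSeq, ih, List.flatMap_assoc]

theorem flip_cons (t : Letter) (e : List Letter) : flip (t :: e) = flip e ++ [t.bar] := by
  simp [flip]

theorem Letter.reverses_add_iff (t : Letter) {c : Fin 8} (hc : c + c = 0) (i : Fin 8) :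
    t.Reverses (i + c) ↔ t.Reverses i := by
  cases t <;> revert c i <;> decide

/-- The letter `h` advances the position along the shell cycle by half a turn. -/
def Letter.halfTurn (t : Letter) : Fin 8 := 4 * (t.radius : ℕ)

theorem Letter.halfTurn_add_halfTurn (t : Letter) : t.halfTurn + t.halfTurn = 0 := by
  cases t <;> rfl

theorem liftType_bar_shellType (t : Letter) (k : Fin 8) :
    liftType t.bar (shellType (k + t.halfTurn)) =
      if t.Reverses k then (centredArc t.radius k).reverse.map reversedShellType
      else (centredArc (t.radius + 1) k).map shellType := by
  cases t <;> revert k <;> decide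

theorem liftType_bar_reversedShellType (t : Letter) (k : Fin 8) :
    liftType t.bar (reversedShellType (k + t.halfTurn)) =
      if t.Reverses k then (centredArc t.radius k).map shellType
      else (centredArc (t.radius + 1) k).reverse.map reversedShellType := by
  cases t <;> revert k <;> decide

variable {G : Type*} [Group G] {L : Fin 8 → G}

theorem prod_map_reverseWord (hL : Antipodal L) (w : List (Fin 8)) :
    ((reverseWord w).map L).prod = ((w.map L).prod)⁻¹ := by
  rw [List.prod_inv_reverse, reverseWord, List.map_reverse, List.map_map, List.map_map]
  exact congrArg (fun l => l.reverse.prod) (List.map_congr_left fun k _ => hL k)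

theorem prod_map_pathRun (U : Fin 8 → List (Fin 8)) (X : Fin 8 → Fin 8) (n : ℕ) (i : Fin 8) :
    ((pathRun U X n i).map L).prod =
      blockRun (fun j => ((U j).map L).prod) (fun j => L (X j)) n i := by
  induction n generalizing i with
  | zero => rfl
  | succ n ih =>
    rw [pathRun, blockRun, List.map_append, List.map_cons, List.prod_append, List.prod_cons, ih,
      mul_assoc]

theorem prod_map_nextWord (hL : Antipodal L) (t : Letter) (U : Fin 8 → List (Fin 8))
    (X : Fin 8 → Fin 8) (i : Fin 8) :
    ((nextWord t U X i).map L).prod =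
      if t.Reverses i then
        (centredRun (fun j => ((U j).map L).prod) (fun j => L (X j)) (t.radius + 1) (i + 4))⁻¹
      else centredRun (fun j => ((U j).map L).prod) (fun j => L (X j)) t.radius i := by
  rw [nextWord]
  split_ifs
  · rw [prod_map_reverseWord hL, prod_map_pathRun, centredRun]
  · rw [prod_map_pathRun, centredRun]

theorem isConj_prod_of_isRotated {l l' : List G} (h : l ~r l') : IsConj l.prod l'.prod := by
  obtain ⟨n, rfl⟩ := h
  rw [List.rotate_eq_drop_append_take_mod, List.prod_append, isConj_iff]
  refine ⟨(l.take (n % l.length)).prod⁻¹, ?_⟩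
  rw [← List.prod_take_mul_prod_drop l (n % l.length)]
  group

theorem isRotated_arc_seven (k : Fin 8) : arc 7 k ~r arc 7 0 := by
  revert k; decide

theorem prod_map_flatMap {α β : Type*} (f : α → List β) (g : β → G) (l : List α) :
    ((l.flatMap f).map g).prod = (l.map fun a => ((f a).map g).prod).prod := by
  simp [List.flatMap, List.prod_flatten, List.map_flatten, Function.comp_def]

variable (L) in
/-- The product of the values of `L` over the lift by `e` of a vertex of type `τ`, relabelled by
`starPerm`. -/
def typeProd (e : List Letter) (τ : VertexType) : G :=
  ((liftTypeSeq e τ).map fun σ => L (starPerm (outDir σ))).prod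

theorem typeProd_nil (τ : VertexType) : typeProd L [] τ = L (starPerm (outDir τ)) := by
  simp [typeProd, liftTypeSeq]

theorem typeProd_flip_cons (t : Letter) (e : List Letter) (τ : VertexType) :
    typeProd L (flip (t :: e)) τ = ((liftType t.bar τ).map (typeProd L (flip e))).prod := by
  rw [typeProd, flip_cons, liftTypeSeq_append, prod_map_flatMap]
  rfl

section

variable {e : List Letter} {a x : Fin 8 → G} {c : Fin 8}

theorem typeProd_flip_cons_shellType (t : Letter) (hc : c + c = 0) (hx : Antipodal x)
    (shell : ∀ k, typeProd L (flip e) (shellType (k + c)) = a k * x k)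
    (reversed : ∀ k,
      typeProd L (flip e) (reversedShellType (k + c)) = (a (k + 4))⁻¹ * x (k - 1)) (k : Fin 8) :
    typeProd L (flip (t :: e)) (shellType (k + c + t.halfTurn)) =
      if t.Reverses k then (centredRun a x t.radius (k + 4))⁻¹ * x (k - t.radius - 1)
      else centredRun a x (t.radius + 1) k * x (k + t.radius + 1) := by
  simp only [typeProd_flip_cons, liftType_bar_shellType, t.reverses_add_iff hc]
  split_ifs
  · simp only [centredArc_add, ← List.map_reverse, List.map_map, Function.comp_def, reversed,
      prod_reverse_centredArc hx]
  · simp only [centredArc_add, List.map_map, Function.comp_def, shell, prod_centredArc]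
    push_cast
    rw [add_assoc k]

theorem typeProd_flip_cons_reversedShellType (t : Letter) (hc : c + c = 0) (hx : Antipodal x)
    (shell : ∀ k, typeProd L (flip e) (shellType (k + c)) = a k * x k)
    (reversed : ∀ k,
      typeProd L (flip e) (reversedShellType (k + c)) = (a (k + 4))⁻¹ * x (k - 1)) (k : Fin 8) :
    typeProd L (flip (t :: e)) (reversedShellType (k + c + t.halfTurn)) =
      if t.Reverses k then centredRun a x t.radius k * x (k + t.radius)
      else (centredRun a x (t.radius + 1) (k + 4))⁻¹ * x (k - t.radius - 1 - 1) := by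
  simp only [typeProd_flip_cons, liftType_bar_reversedShellType, t.reverses_add_iff hc]
  split_ifs
  · simp only [centredArc_add, List.map_map, Function.comp_def, shell, prod_centredArc]
  · simp only [centredArc_add, ← List.map_reverse, List.map_map, Function.comp_def, reversed,
      prod_reverse_centredArc hx]
    push_cast
    rw [sub_add_eq_sub_sub]

end

theorem exists_gauge (hL : Antipodal L) (e : List Letter) :
    ∃ c : Fin 8, c + c = 0 ∧ ∃ a x g h : Fin 8 → G,
      Gauge (fun k => ((pathWord e k).map L).prod) (fun k => L (junctionLabel e k)) a x g h ∧
      (∀ k, typeProd L (flip e) (shellType (k + c)) = a k * x k) ∧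
      ∀ k, typeProd L (flip e) (reversedShellType (k + c)) = (a (k + 4))⁻¹ * x (k - 1) := by
  induction e with
  | nil =>
    refine ⟨0, rfl, fun _ => 1, L, fun _ => 1, fun _ => 1, ⟨hL, hL, ?_, ?_, ?_⟩, ?_, ?_⟩ <;>
      simp [pathWord, junctionLabel, flip, typeProd_nil, starPerm_outDir_shellType,
        starPerm_outDir_reversedShellType]
  | cons t e ih =>
    obtain ⟨c, hc, a, x, g, h, H, hs, hr⟩ := ih
    have S := H.step t.radius t.reverses_add_one_iff
    have hA : (fun k => ((pathWord (t :: e) k).map L).prod) = _ :=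
      funext fun k => prod_map_nextWord hL t (pathWord e) (junctionLabel e) k
    have hX : (fun k => L (junctionLabel (t :: e) k)) = _ :=
      funext fun k => apply_ite L (t.Reverses k) _ _
    rw [← hA, ← hX] at S
    refine ⟨c + t.halfTurn, ?_, _, _, _, _, S, fun k => ?_, fun k => ?_⟩
    · rw [add_add_add_comm, hc, t.halfTurn_add_halfTurn, add_zero]
    · rw [← add_assoc, typeProd_flip_cons_shellType t hc H.antipodal' hs hr]
      by_cases hk : t.Reverses k <;> simp only [hk, if_true, if_false]
    · rw [← add_assoc, typeProd_flip_cons_reversedShellType t hc H.antipodal' hs hr]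
      have pred := t.reverses_add_one_iff (k - 1)
      rw [sub_add_cancel] at pred
      simp only [t.reverses_add_iff (c := 4) rfl, pred, ite_not]
      by_cases hk : t.Reverses (k - 1) <;> simp only [hk, if_true, if_false, inv_inv]
      · rw [sub_right_comm k (t.radius : Fin 8)]
      · rw [show k - 1 + t.radius + 1 = k + (t.radius : Fin 8) by ring, add_assoc,
          show k + (4 + 4) = k from add_zero k]

theorem isConj_firstWord_secondWord (hL : Antipodal L) (e : List Letter) :
    IsConj ((((firstWord (flip e)).map starPerm).map L).prod) ((secondWord e).map L).prod := by
  obtain ⟨c, -, a, x, g, h, H, shell, -⟩ := exists_gauge hL e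
  have first : (((firstWord (flip e)).map starPerm).map L).prod =
      ((arc 7 (7 - c)).map fun j => a j * x j).prod := by
    have harc : arc 7 7 = (arc 7 (7 - c)).map (· + c) := by rw [← arc_add, sub_add_cancel]
    rw [firstWord, firstTypes, harc, List.map_map, List.map_map, prod_map_flatMap, List.map_map,
      List.map_map]
    exact congrArg List.prod (List.map_congr_left fun k _ => shell k)
  have second : ((secondWord e).map L).prod =
      ((arc 7 0).map fun j => ((pathWord e j).map L).prod * L (junctionLabel e j)).prod := by
    simp [secondWord, List.ofFn_succ, arc, mul_assoc]
  rw [first, second, H.prod_arc]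
  exact (isConj_prod_of_isRotated (((isRotated_arc_seven _).map _))).trans
    (isConj_iff.2 ⟨g 0, rfl⟩)

/-- The directions as letters over four generators, opposite directions being mutually inverse. -/
def dirLetter (k : Fin 8) : Fin 4 × Bool := (⟨k.val % 4, by omega⟩, decide (k.val < 4))

theorem dirLetter_injective : Function.Injective dirLetter := by decide

theorem mk_map_dirLetter (w : List (Fin 8)) :
    FreeGroup.mk (w.map dirLetter) = (w.map fun k => FreeGroup.mk [dirLetter k]).prod := by
  induction w with
  | nil => rfl
  | cons k w ih => rw [List.map_cons, List.map_cons, List.prod_cons, ← ih, FreeGroup.mul_mk]; rfl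

theorem antipodal_mk_dirLetter : Antipodal fun k => FreeGroup.mk [dirLetter k] := by
  have h : ∀ k, dirLetter (k + 4) = ((dirLetter k).1, !(dirLetter k).2) := by decide
  intro k
  simp [h, FreeGroup.inv_mk, FreeGroup.invRev]

/-- Read cyclically, the word `w` of directions never turns back along its last letter: the
letters `k` and `k + 4` are mutually inverse. -/
def NoBacktrack (w : List (Fin 8)) : Prop := (w ++ w).IsChain fun a b => b ≠ a + 4

theorem NoBacktrack.isCyclicallyReduced {w : List (Fin 8)} (h : NoBacktrack w) :
    FreeGroup.IsCyclicallyReduced (w.map dirLetter) := by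
  have key : ∀ a b : Fin 8, b ≠ a + 4 → (dirLetter a).1 = (dirLetter b).1 →
      (dirLetter a).2 = (dirLetter b).2 := by decide
  obtain ⟨chain, -, wrap⟩ := List.isChain_append.1 h
  refine ⟨(List.isChain_map _).2 (chain.imp key), ?_⟩
  simp only [List.getLast?_map, List.head?_map, Option.mem_def, Option.map_eq_some_iff]
  rintro _ ⟨a, ha, rfl⟩ _ ⟨b, hb, rfl⟩
  exact key a b (wrap a ha b hb)

theorem isRotated_firstWord_secondWord (e : List Letter)
    (h₁ : NoBacktrack ((firstWord (flip e)).map starPerm)) (h₂ : NoBacktrack (secondWord e)) :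
    (firstWord (flip e)).map starPerm ~r secondWord e := by
  have hconj := isConj_firstWord_secondWord antipodal_mk_dirLetter e
  rw [← mk_map_dirLetter, ← mk_map_dirLetter] at hconj
  obtain ⟨n, hn⟩ :=
    isRotated_of_isConj_mk h₁.isCyclicallyReduced h₂.isCyclicallyReduced hconj
  rw [← List.map_rotate] at hn
  exact ⟨n, dirLetter_injective.list_map hn⟩

end Words

/-! ### Closed lists of squares -/

section Closed

theorem shellType_add_four (k : Fin 8) :
    shellType (k + 4) = ((shellType k).1 + 4, (shellType k).2) := by
  revert k; decide

theorem liftTypeSeq_antipode (e : List Letter) (τ : VertexType) :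
    liftTypeSeq e (τ.1 + 4, τ.2) = (liftTypeSeq e τ).map fun σ => (σ.1 + 4, σ.2) := by
  induction e with
  | nil => rfl
  | cons t e ih =>
    have liftType_antipode : ∀ σ : VertexType,
        liftType t (σ.1 + 4, σ.2) = (liftType t σ).map fun σ => (σ.1 + 4, σ.2) := by
      cases t <;> decide
    simp only [liftTypeSeq, ih, List.flatMap_map, List.map_flatMap, liftType_antipode]

theorem outDir_antipode (τ : VertexType) : outDir (τ.1 + 4, τ.2) = outDir τ + 4 := by
  revert τ; decide

variable {G : Type*} [CommGroup G] {L : Fin 8 → G}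

theorem prod_map_map_add_four (hL : Antipodal L) (w : List (Fin 8)) :
    ((w.map (· + 4)).map L).prod = ((w.map L).prod)⁻¹ := by
  rw [← prod_map_reverseWord hL, reverseWord, List.map_reverse, List.prod_reverse]

theorem prod_map_firstWord (hL : Antipodal L) (e : List Letter) :
    ((firstWord e).map L).prod = 1 := by
  set u := (((arc 3 7).map shellType).flatMap (liftTypeSeq e)).map outDir
  have split : firstWord e = u ++ u.map (· + 4) := by
    have arcs : arc 7 7 = arc 3 7 ++ (arc 3 7).map (· + 4) := by decide
    simp only [firstWord, firstTypes, arcs, u, List.map_append, List.flatMap_append, List.map_map,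
      List.map_flatMap, List.flatMap_map, Function.comp_def, shellType_add_four,
      liftTypeSeq_antipode, outDir_antipode]
  rw [split, List.map_append, List.prod_append, prod_map_map_add_four hL, mul_inv_cancel]

theorem starPerm_add_four (k : Fin 8) : starPerm (k + 4) = starPerm k + 4 := by
  revert k; decide

theorem prod_map_secondWord (hL : Antipodal L) (e : List Letter) :
    ((secondWord e).map L).prod = 1 := by
  rw [← isConj_iff_eq.1 (isConj_firstWord_secondWord hL e), List.map_map]
  exact prod_map_firstWord (fun k => by
    rw [Function.comp_apply, starPerm_add_four]; exact hL _) _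

end Closed

section CyclicLists

/-- The entries of the list `l`, read cyclically. -/
def cyc {α : Type*} [Inhabited α] (l : List α) (k : ℕ) : α := l.getD (k % l.length) default

variable {α β : Type*} [Inhabited α] [Inhabited β] {l : List α} {R : α → α → Prop}

theorem cyc_of_lt {k : ℕ} (hk : k < l.length) : cyc l k = l[k] := by
  simp [cyc, Nat.mod_eq_of_lt hk, hk]

theorem cyc_congr {j k : ℕ} (h : j ≡ k [MOD l.length]) : cyc l j = cyc l k := by
  rw [cyc, cyc, h]

theorem cyc_mod (k : ℕ) : cyc l (k % l.length) = cyc l k := cyc_congr (Nat.mod_modEq _ _)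

theorem mem_iff_exists_cyc (hl : l ≠ []) {x : α} : x ∈ l ↔ ∃ k, cyc l k = x := by
  refine ⟨fun h => ?_, ?_⟩
  · obtain ⟨k, hk, rfl⟩ := List.getElem_of_mem h
    exact ⟨k, cyc_of_lt hk⟩
  · rintro ⟨k, rfl⟩
    rw [← cyc_mod, cyc_of_lt (Nat.mod_lt _ (List.length_pos_iff.2 hl))]
    exact List.getElem_mem _

theorem cyc_inj (hl : l.Nodup) (hne : l ≠ []) {j k : ℕ} :
    cyc l j = cyc l k ↔ j ≡ k [MOD l.length] := by
  refine ⟨fun h => ?_, cyc_congr⟩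
  have pos := List.length_pos_iff.2 hne
  rw [← cyc_mod j, ← cyc_mod k, cyc_of_lt (Nat.mod_lt _ pos), cyc_of_lt (Nat.mod_lt _ pos)] at h
  exact hl.getElem_inj_iff.1 h

theorem cyc_map (f : α → β) (hl : l ≠ []) (k : ℕ) : cyc (l.map f) k = f (cyc l k) := by
  have hk := Nat.mod_lt k (List.length_pos_iff.2 hl)
  rw [← cyc_mod, ← cyc_mod (l := l), List.length_map, cyc_of_lt hk,
    cyc_of_lt (by simpa using hk), List.getElem_map]

theorem cyc_rotate (hl : l ≠ []) (n k : ℕ) : cyc (l.rotate n) k = cyc l (k + n) := by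
  have pos := List.length_pos_iff.2 hl
  have hk := Nat.mod_lt k pos
  rw [← cyc_mod, ← cyc_mod (l := l), List.length_rotate,
    cyc_of_lt (by simpa using hk), List.getElem_rotate, cyc_of_lt (Nat.mod_lt _ pos)]
  simp only [Nat.mod_add_mod]

theorem getElem_append_self {k : ℕ} (hk : k < (l ++ l).length) : (l ++ l)[k] = cyc l k := by
  rcases lt_or_ge k l.length with h | h
  · rw [List.getElem_append_left h, cyc_of_lt h]
  · obtain ⟨j, rfl⟩ := Nat.exists_eq_add_of_le h
    rw [List.length_append, Nat.add_lt_add_iff_left] at hk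
    rw [List.getElem_append_right h, cyc_congr (Nat.add_modEq_left), cyc_of_lt hk]
    simp only [Nat.add_sub_cancel_left]

theorem isChain_append_self_iff (hl : l ≠ []) :
    (l ++ l).IsChain R ↔ ∀ k, R (cyc l k) (cyc l (k + 1)) := by
  simp only [List.isChain_iff_getElem, getElem_append_self]
  refine ⟨fun h k => ?_, fun h k _ => h k⟩
  have pos := List.length_pos_iff.2 hl
  have hk := Nat.mod_lt k pos
  have := h (k % l.length) (by rw [List.length_append]; omega)
  rwa [cyc_mod, cyc_congr ((Nat.mod_modEq k _).add_right 1)] at this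

theorem exists_add_modEq (n k : ℕ) {N : ℕ} (hN : 0 < N) : ∃ j, j + n ≡ k [MOD N] := by
  refine ⟨k + n * (N - 1), ?_⟩
  rw [add_assoc, ← Nat.mul_add_one, Nat.sub_add_cancel hN]
  exact Nat.add_mul_modulus_modEq_iff.2 rfl

theorem exists_cyclic_antiderivative {A : Type*} [AddCommGroup A] {L : α → A}
    (hl : (l.map L).sum = 0) :
    ∃ ψ : ℕ → A, (∀ k, ψ (k + 1) = ψ k + L (cyc l k)) ∧ ψ.Periodic l.length := by
  refine ⟨fun k => ∑ i ∈ Finset.range k, L (cyc l i), fun k => Finset.sum_range_succ _ k,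
    fun k => ?_⟩
  induction k with
  | zero =>
    simp only [zero_add, Finset.sum_range, cyc_of_lt (Fin.is_lt _)]
    exact (Fin.sum_univ_fun_getElem l L).trans hl
  | succ k ih =>
    simp only [add_right_comm k, Finset.sum_range_succ, ih,
      cyc_congr (l := l) (Nat.add_modEq_right (a := k))]

end CyclicLists

section Follows

/-- The closed list `l` of points follows the cyclic word `w`, the letter `i` standing for the
translation `v i`. -/
structure Follows {ι A : Type*} [Inhabited ι] [Inhabited A] [AddGroup A] (v : ι → A) (l : List A)
    (w : List ι) : Prop where
  length_eq : w.length = l.length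
  step : ∀ k, cyc l (k + 1) = cyc l k + v (cyc w k)

variable {ι A B : Type*} [Inhabited ι] [Inhabited A] [AddGroup A] [AddCommGroup B]

theorem Follows.noBacktrack {v : Fin 8 → A} {l : List A} {w : List (Fin 8)}
    (h : Follows v l w) (hv : ∀ i, v (i + 4) = -v i) (hl : l.Nodup) (three_le : 3 ≤ l.length) :
    NoBacktrack w := by
  have hw : w ≠ [] := List.ne_nil_of_length_pos (by rw [h.length_eq]; omega)
  refine (isChain_append_self_iff hw).2 fun k hk => ?_
  have back : cyc l (k + 2) = cyc l (k + 0) := by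
    rw [h.step, h.step, hk, hv, add_neg_cancel_right, add_zero]
  have two_modEq := ((cyc_inj hl (List.ne_nil_of_length_pos (by omega))).1 back).add_left_cancel'
  have := Nat.le_of_dvd two_pos (Nat.modEq_zero_iff_dvd.1 two_modEq)
  omega

theorem Follows.exists_potential {v : ι → A} {l : List A} {w : List ι} (h : Follows v l w)
    (hl : l.Nodup) (hne : l ≠ []) {L : ι → B} (hL : (w.map L).sum = 0) :
    ∃ ψ : A → B, ∀ k, L (cyc w k) = ψ (cyc l (k + 1)) - ψ (cyc l k) := by
  obtain ⟨ψ, step, periodic⟩ := exists_cyclic_antiderivative hL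
  have factors : ψ.FactorsThrough (cyc l) := fun j k hjk => by
    rw [← periodic.map_mod_nat j, ← periodic.map_mod_nat k, h.length_eq, (cyc_inj hl hne).1 hjk]
  refine ⟨Function.extend (cyc l) ψ 0, fun k => ?_⟩
  rw [factors.extend_apply, factors.extend_apply, step, add_sub_cancel_left]

end Follows

section Cycles

variable {V : Type*} {G : SimpleGraph V}

theorem exists_isCycle_of_adj_cyc [Inhabited V] {l : List V} (hl : l.Nodup)
    (three_le : 3 ≤ l.length) (hadj : ∀ k, G.Adj (cyc l k) (cyc l (k + 1))) :
    ∃ (a : V) (w : G.Walk a a), w.IsCycle ∧ w.support.dropLast = l := by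
  obtain ⟨a, l, rfl⟩ := List.exists_cons_of_length_pos (by omega : 0 < l.length)
  have chain : (a :: l ++ [a]).IsChain G.Adj :=
    List.IsChain.left_of_append (l₂ := l)
      (by simpa using (isChain_append_self_iff (List.cons_ne_nil a l)).2 hadj)
  obtain ⟨w, support⟩ : ∃ w : G.Walk a a, w.support = a :: l ++ [a] :=
    ⟨(SimpleGraph.Walk.ofSupport (a :: l ++ [a]) (by simp) chain).copy rfl (by simp),
      (SimpleGraph.Walk.support_copy _ _ _).trans (SimpleGraph.Walk.support_ofSupport _ _)⟩
  have length : w.length = l.length + 1 := by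
    simpa [w.length_support] using congrArg List.length support
  have not_nil : ¬ w.Nil := by simp [SimpleGraph.Walk.not_nil_iff_lt_length, length]
  refine ⟨a, w, SimpleGraph.Walk.isCycle_iff_isPath_tail_and_le_length.2 ⟨?_, ?_⟩, ?_⟩
  · rw [SimpleGraph.Walk.isPath_def, SimpleGraph.Walk.support_tail_of_not_nil _ not_nil,
      (SimpleGraph.Walk.tail_support_perm_dropLast_support _).nodup_iff, support,
      List.dropLast_concat]
    exact hl
  · rw [length]; exact three_le
  · rw [support, List.dropLast_concat]

theorem getVert_eq_cyc [Inhabited V] {a : V} {w : G.Walk a a}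
    (hw : w.IsCycle) {k : ℕ} (hk : k ≤ w.length) : w.getVert k = cyc w.support.dropLast k := by
  have length_pos := three_pos.trans_le hw.three_le_length
  rcases hk.lt_or_eq with hk | rfl
  · rw [cyc_of_lt (by simpa using hk), List.getElem_dropLast,
      SimpleGraph.Walk.getVert_eq_support_getElem _ hk.le]
  · rw [SimpleGraph.Walk.getVert_length, cyc_congr (k := 0) (by simp [Nat.ModEq]),
      cyc_of_lt (by simpa using length_pos), List.getElem_dropLast,
      SimpleGraph.Walk.support_getElem_zero]

end Cycles

section IsCycleThrough

variable {p q : ℤ} {l : List Square} {C : (leaperGraph p q).Subgraph}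

theorem exists_isCycleThrough (hl : l.Nodup) (three_le : 3 ≤ l.length)
    (hadj : ∀ k, (leaperGraph p q).Adj (cyc l k) (cyc l (k + 1))) :
    ∃ C : (leaperGraph p q).Subgraph, IsCycleThrough l C := by
  obtain ⟨a, w, hw, support⟩ := exists_isCycle_of_adj_cyc hl three_le hadj
  exact ⟨w.toSubgraph, a, w, hw, support, rfl⟩

theorem IsCycle.exists_isCycleThrough (h : IsCycle C) : ∃ l, IsCycleThrough l C := by
  obtain ⟨a, w, hw, rfl⟩ := h
  exact ⟨_, a, w, hw, rfl, rfl⟩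

namespace IsCycleThrough

theorem isCycle (h : IsCycleThrough l C) : IsCycle C := by
  obtain ⟨a, w, hw, -, hC⟩ := h
  exact ⟨a, w, hw, hC⟩

theorem nodup (h : IsCycleThrough l C) : l.Nodup := by
  obtain ⟨a, w, hw, rfl, -⟩ := h
  exact hw.nodup_dropLast_support

theorem three_le_length (h : IsCycleThrough l C) : 3 ≤ l.length := by
  obtain ⟨a, w, hw, rfl, -⟩ := h
  simpa using hw.three_le_length

theorem ne_nil (h : IsCycleThrough l C) : l ≠ [] :=
  List.ne_nil_of_length_pos (three_pos.trans_le h.three_le_length)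

theorem mem_verts (h : IsCycleThrough l C) {x : Square} : x ∈ C.verts ↔ x ∈ l := by
  have ne_nil := h.ne_nil
  obtain ⟨a, w, hw, rfl, rfl⟩ := h
  rw [SimpleGraph.Walk.mem_verts_toSubgraph]
  refine ⟨fun h => ?_, List.mem_of_mem_dropLast⟩
  obtain ⟨k, rfl, hk⟩ := SimpleGraph.Walk.mem_support_iff_exists_getVert.1 h
  rw [getVert_eq_cyc hw hk, mem_iff_exists_cyc ne_nil]
  exact ⟨k, rfl⟩

theorem adj_iff (h : IsCycleThrough l C) {x y : Square} :
    C.Adj x y ↔ ∃ k, x = cyc l k ∧ y = cyc l (k + 1) ∨ x = cyc l (k + 1) ∧ y = cyc l k := by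
  obtain ⟨a, w, hw, rfl, rfl⟩ := h
  have edge : ∀ k < w.length, s(x, y) = s(w.getVert k, w.getVert (k + 1)) ↔
      x = cyc w.support.dropLast k ∧ y = cyc w.support.dropLast (k + 1) ∨
        x = cyc w.support.dropLast (k + 1) ∧ y = cyc w.support.dropLast k := fun k hk => by
    rw [getVert_eq_cyc hw hk.le, getVert_eq_cyc hw hk, Sym2.eq_iff]
  rw [SimpleGraph.Walk.toSubgraph_adj_iff]
  refine ⟨fun ⟨k, hk, hlt⟩ => ⟨k, (edge k hlt).1 (by rw [← hk])⟩, fun ⟨k, hk⟩ => ?_⟩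
  have hlt : k % w.length < w.length := Nat.mod_lt _ (three_pos.trans_le hw.three_le_length)
  refine ⟨k % w.length, ((edge _ hlt).2 ?_).symm, hlt⟩
  have modEq : k % w.length ≡ k [MOD w.support.dropLast.length] := by simpa using Nat.mod_modEq k _
  rwa [cyc_congr modEq, cyc_congr (modEq.add_right 1)]

end IsCycleThrough

end IsCycleThrough

section DirVec

/-- The move of direction `i` of the `(p, q)`-leaper. -/
def dirVec (p q : ℤ) : Fin 8 → Square :=
  ![(q, p), (p, q), (-p, q), (-q, p), (-q, -p), (-p, -q), (p, -q), (q, -p)]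

variable {p q : ℤ}

theorem isMoveOfDirection_iff {i : Fin 8} {v : Square} :
    IsMoveOfDirection p q i v ↔ v = dirVec p q i := by
  rcases v with ⟨a, b⟩
  rw [IsMoveOfDirection, funext_iff, Fin.forall_fin_two, Prod.ext_iff]
  fin_cases i <;> simp [dirMatrix, dirVec, Matrix.mulVec, dotProduct, Fin.sum_univ_two]

theorem dirVec_add_four (p q : ℤ) (i : Fin 8) : dirVec p q (i + 4) = -dirVec p q i := by
  fin_cases i <;> simp [dirVec]

theorem dirVec_injective (hp : 0 < p) (hq : p < q) : Function.Injective (dirVec p q) := by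
  intro i j h
  fin_cases i <;> fin_cases j <;> simp [dirVec] at h ⊢ <;> omega

theorem dirVec_ne_zero (hp : 0 < p) (i : Fin 8) : dirVec p q i ≠ 0 := by
  fin_cases i <;> simp [dirVec, hp.ne']

theorem isMove_iff (hp : 0 < p) (hq : p < q) {v : Square} :
    IsMove p q v ↔ ∃ i, v = dirVec p q i := by
  rcases v with ⟨a, b⟩
  simp only [IsMove, abs_eq hp.le, abs_eq (hp.trans hq).le, Fin.exists_fin_succ, dirVec,
    Prod.ext_iff]
  simp only [Fin.isValue, Matrix.cons_val_zero, Fin.succ_zero_eq_one, Matrix.cons_val_one,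
    Fin.succ_one_eq_two, Matrix.cons_val, Fin.reduceSucc, Matrix.cons_val_succ,
    Matrix.cons_val_fin_one, IsEmpty.exists_iff, or_false]
  tauto

theorem leaperGraph_adj_iff (hp : 0 < p) (hq : p < q) {a b : Square} :
    (leaperGraph p q).Adj a b ↔ ∃ i, b = a + dirVec p q i := by
  simp only [leaperGraph, isMove_iff hp hq, sub_eq_iff_eq_add']
  refine and_iff_right_of_imp ?_
  rintro ⟨i, rfl⟩ h
  exact dirVec_ne_zero hp i (by simpa using h.symm)

end DirVec

section DirectionGraphs

theorem dirMatrix_add_four (i : Fin 8) : dirMatrix (i + 4) = -dirMatrix i := by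
  revert i; decide

theorem dirMatrix_injective : Function.Injective dirMatrix := by decide

theorem isEquivalencePerm_add_four {π : Equiv.Perm (Fin 8)} (h : IsEquivalencePerm π)
    (i : Fin 8) : π (i + 4) = π i + 4 := by
  obtain ⟨P, Q, h⟩ := h
  have cast_injective : Function.Injective fun M : Matrix (Fin 2) (Fin 2) ℤ =>
      M.map (Int.cast : ℤ → ℝ) := Matrix.map_injective Int.cast_injective
  refine dirMatrix_injective (cast_injective ?_)
  have cast_neg (M : Matrix (Fin 2) (Fin 2) ℤ) :
      (-M).map (Int.cast : ℤ → ℝ) = -M.map Int.cast := by ext; simp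
  simp only [h, dirMatrix_add_four, cast_neg, Matrix.mul_neg, Matrix.neg_mul]

theorem exists_equiv_of_surjective {ι V W : Type*} {f : ι → V} {g : ι → W}
    (hf : Function.Surjective f) (hg : Function.Surjective g)
    (h : ∀ j k, f j = f k ↔ g j = g k) : ∃ τ : V ≃ W, ∀ k, τ (f k) = g k := by
  refine ⟨(Setoid.quotientKerEquivOfSurjective f hf).symm.trans
    ((Quotient.congrRight h).trans (Setoid.quotientKerEquivOfSurjective g hg)), fun k => ?_⟩
  have : (Setoid.quotientKerEquivOfSurjective f hf).symm (f k) = ⟦k⟧ := by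
    rw [Equiv.symm_apply_eq]; rfl
  rw [Equiv.trans_apply, this]
  rfl

namespace DirectionGraph

variable {V W : Type*} {Φ : DirectionGraph V} {Ψ : DirectionGraph W} {w : List (Fin 8)}

/-- `f` runs cyclically through the vertices of the direction graph `Φ`, which is a cycle, along
arcs labelled by the cyclic word `w`. -/
structure IsTraversal (Φ : DirectionGraph V) (w : List (Fin 8)) (f : ℕ → V) : Prop where
  ne_nil : w ≠ []
  surjective : Function.Surjective f
  apply_eq_iff : ∀ j k, f j = f k ↔ j ≡ k [MOD w.length]
  arc_iff : ∀ x y i, Φ.Arc x y i ↔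
    ∃ k, x = f k ∧ y = f (k + 1) ∧ i = cyc w k ∨ x = f (k + 1) ∧ y = f k ∧ i = cyc w k + 4

theorem IsTraversal.rotate {f : ℕ → V} (h : Φ.IsTraversal w f) (n : ℕ) :
    Φ.IsTraversal (w.rotate n) fun k => f (k + n) := by
  have back : ∀ k, ∃ j, j + n ≡ k [MOD w.length] := fun k =>
    exists_add_modEq n k (List.length_pos_iff.2 h.ne_nil)
  refine ⟨by simpa using h.ne_nil, fun x => ?_, fun j k => ?_, fun x y i => ?_⟩
  · obtain ⟨k, rfl⟩ := h.surjective x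
    obtain ⟨j, hj⟩ := back k
    exact ⟨j, (h.apply_eq_iff _ _).2 hj⟩
  · rw [h.apply_eq_iff, List.length_rotate]
    exact ⟨fun h => h.add_right_cancel' n, fun h => h.add_right n⟩
  · simp only [h.arc_iff, cyc_rotate h.ne_nil, add_right_comm _ 1 n]
    refine ⟨fun ⟨k, hk⟩ => ?_, fun ⟨k, hk⟩ => ⟨k + n, hk⟩⟩
    obtain ⟨j, hj⟩ := back k
    refine ⟨j, ?_⟩
    rwa [(h.apply_eq_iff _ _).2 hj, (h.apply_eq_iff _ _).2 (hj.add_right 1), cyc_congr hj]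

theorem IsTraversal.equivalent {w' : List (Fin 8)} {f : ℕ → V} {g : ℕ → W}
    (h : Φ.IsTraversal w f) (h' : Ψ.IsTraversal w' g) {π : Equiv.Perm (Fin 8)}
    (hπ : IsEquivalencePerm π) (hw : w.map π ~r w') : Φ.Equivalent Ψ := by
  obtain ⟨n, rfl⟩ := hw
  rw [← List.map_rotate] at h'
  have hn := h.rotate n
  obtain ⟨τ, hτ⟩ := exists_equiv_of_surjective hn.surjective h'.surjective fun j k => by
    rw [hn.apply_eq_iff, h'.apply_eq_iff, List.length_map]
  refine ⟨π, hπ, τ, fun x y i => ?_⟩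
  simp only [hn.arc_iff, h'.arc_iff, cyc_map π hn.ne_nil, ← isEquivalencePerm_add_four hπ,
    ← hτ, τ.injective.eq_iff, π.injective.eq_iff]

/-- The labels of the arcs are the increments of a potential `ψ`, hence their matrices sum to zero
over every cycle. -/
def ofPotential (Arc : V → V → Fin 8 → Prop) (symm : ∀ x y i, Arc x y i → ∃ j, Arc y x j)
    (ψ : V → Matrix (Fin 2) (Fin 2) ℤ) (hψ : ∀ x y i, Arc x y i → dirMatrix i = ψ y - ψ x) :
    DirectionGraph V where
  Arc := Arc
  symm := symm
  cycle_sum n x l _ h := by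
    simp only [hψ _ _ _ (h _), Finset.sum_sub_distrib, sub_eq_zero]
    exact Equiv.sum_comp (Equiv.addRight (1 : Fin (n + 1))) fun k => ψ (x k)

end DirectionGraph

variable {p q : ℤ} {l : List Square} {C : (leaperGraph p q).Subgraph} {w : List (Fin 8)}

theorem IsCycleThrough.adj_and_isMoveOfDirection_iff (hp : 0 < p) (hq : p < q)
    (hC : IsCycleThrough l C) (hw : Follows (dirVec p q) l w) {x y : Square} {i : Fin 8} :
    C.Adj x y ∧ IsMoveOfDirection p q i (y - x) ↔
      ∃ k, x = cyc l k ∧ y = cyc l (k + 1) ∧ i = cyc w k ∨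
        x = cyc l (k + 1) ∧ y = cyc l k ∧ i = cyc w k + 4 := by
  rw [hC.adj_iff, ← exists_and_right]
  refine exists_congr fun k => ?_
  rw [or_and_right, and_assoc, and_assoc]
  refine or_congr ?_ ?_ <;> refine and_congr_right ?_ <;> rintro rfl <;>
    refine and_congr_right ?_ <;> rintro rfl
  · rw [isMoveOfDirection_iff, hw.step, add_sub_cancel_left, (dirVec_injective hp hq).eq_iff,
      eq_comm]
  · rw [isMoveOfDirection_iff, hw.step, sub_add_cancel_left, ← dirVec_add_four,
      (dirVec_injective hp hq).eq_iff, eq_comm]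

theorem IsExtractedFrom.exists_isTraversal {V : Type*} {Φ : DirectionGraph V} (hp : 0 < p)
    (hq : p < q) (hΦ : IsExtractedFrom Φ C) (hC : IsCycleThrough l C)
    (hw : Follows (dirVec p q) l w) : ∃ f, Φ.IsTraversal w f := by
  obtain ⟨σ, hσ⟩ := hΦ
  have visited (k : ℕ) : cyc l k ∈ C.verts :=
    hC.mem_verts.2 ((mem_iff_exists_cyc hC.ne_nil).2 ⟨k, rfl⟩)
  refine ⟨fun k => σ ⟨cyc l k, visited k⟩, ?_, fun x => ?_, fun j k => ?_, fun x y i => ?_⟩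
  · exact List.ne_nil_of_length_pos (by rw [hw.length_eq]; exact List.length_pos_iff.2 hC.ne_nil)
  · obtain ⟨⟨a, ha⟩, rfl⟩ := σ.surjective x
    obtain ⟨k, rfl⟩ := (mem_iff_exists_cyc hC.ne_nil).1 (hC.mem_verts.1 ha)
    exact ⟨k, rfl⟩
  · rw [σ.injective.eq_iff, Subtype.mk.injEq, cyc_inj hC.nodup hC.ne_nil, hw.length_eq]
  · obtain ⟨a, rfl⟩ := σ.surjective x
    obtain ⟨b, rfl⟩ := σ.surjective y
    simp only [← hσ, hC.adj_and_isMoveOfDirection_iff hp hq hw, σ.injective.eq_iff,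
      Subtype.ext_iff]

theorem exists_isExtractedFrom (hp : 0 < p) (hq : p < q) (hC : IsCycleThrough l C)
    (hw : Follows (dirVec p q) l w) (hsum : (w.map dirMatrix).sum = 0) :
    ∃ (V : Type) (Φ : DirectionGraph V), IsExtractedFrom Φ C := by
  obtain ⟨ψ, hψ⟩ := hw.exists_potential hC.nodup hC.ne_nil hsum
  refine ⟨C.verts, .ofPotential
    (fun a b i => C.Adj a b ∧ IsMoveOfDirection p q i ((b : Square) - a))
    (fun a b i ⟨adj, move⟩ => ⟨i + 4, adj.symm, ?_⟩) (fun a => ψ a) (fun a b i arc => ?_),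
    Equiv.refl _, fun a b i => Iff.rfl⟩
  · rw [isMoveOfDirection_iff] at move ⊢
    rw [dirVec_add_four, ← move, neg_sub]
  · obtain ⟨k, ⟨ha, hb, rfl⟩ | ⟨ha, hb, rfl⟩⟩ :=
      (hC.adj_and_isMoveOfDirection_iff hp hq hw).1 arc
    · rw [ha, hb, hψ]
    · rw [ha, hb, dirMatrix_add_four, hψ, neg_sub]

end DirectionGraphs

/-! ### Leapers on the board of a frame -/

section CyclesInSparseSets

variable {V : Type*} {G : SimpleGraph V} {S : Set V}

theorem toSubgraph_le_of_neighborSet_inter_subset {H : G.Subgraph}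
    (hH : ∀ x ∈ H.verts, G.neighborSet x ∩ S ⊆ H.neighborSet x) {a b : V} (w : G.Walk a b)
    (hw : ∀ x ∈ w.support, x ∈ S) (ha : a ∈ H.verts) : w.toSubgraph ≤ H := by
  induction w with
  | nil => exact (SimpleGraph.singletonSubgraph_le_iff _ _).2 ha
  | cons h w ih =>
    rw [SimpleGraph.Walk.support_cons] at hw
    have hw' := List.forall_mem_of_forall_mem_cons hw
    have adj : H.Adj _ _ := hH _ ha ⟨h, hw' _ w.start_mem_support⟩
    exact sup_le (SimpleGraph.subgraphOfAdj_le_of_adj H adj) (ih hw' (H.edge_vert adj.symm))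

theorem neighborSet_inter_subset_toSubgraph (hS : ∀ x, (G.neighborSet x ∩ S).encard ≤ 2)
    {a : V} {w : G.Walk a a} (hw : w.IsCycle) (hwS : ∀ x ∈ w.support, x ∈ S) {x : V}
    (hx : x ∈ w.support) : G.neighborSet x ∩ S ⊆ w.toSubgraph.neighborSet x := by
  have two := hw.ncard_neighborSet_toSubgraph_eq_two hx
  have subset : w.toSubgraph.neighborSet x ⊆ G.neighborSet x ∩ S := fun y hy =>
    ⟨hy.adj_sub, hwS y (w.mem_verts_toSubgraph.1 (w.toSubgraph.edge_vert hy.symm))⟩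
  have finite : (w.toSubgraph.neighborSet x).Finite := Set.finite_of_ncard_ne_zero (by omega)
  refine (finite.eq_of_subset_of_encard_le subset ?_).ge
  rw [← finite.cast_ncard_eq, two]
  exact hS x

theorem toSubgraph_le_of_isCycle (hS : ∀ x, (G.neighborSet x ∩ S).encard ≤ 2)
    {a b : V} {w : G.Walk a a} {w' : G.Walk b b} (hw' : w'.IsCycle)
    (hwS : ∀ x ∈ w.support, x ∈ S) (hwS' : ∀ x ∈ w'.support, x ∈ S) {x : V} (hx : x ∈ w.support)
    (hx' : x ∈ w'.support) : w.toSubgraph ≤ w'.toSubgraph := by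
  classical
  rw [← SimpleGraph.Walk.toSubgraph_rotate w hx]
  refine toSubgraph_le_of_neighborSet_inter_subset (S := S) (fun y hy => ?_) _ (fun y hy => ?_)
    (w'.mem_verts_toSubgraph.2 hx')
  · exact neighborSet_inter_subset_toSubgraph hS hw' hwS' (w'.mem_verts_toSubgraph.1 hy)
  · exact hwS y ((w.mem_support_rotate_iff _ hx).1 hy)

end CyclesInSparseSets

section Board

theorem mem_board_iff {F : ℤ × ℤ} {s : Square} : s ∈ board F ↔
    (-(F.1 + F.2) < 2 * s.1 ∧ 2 * s.1 < F.1 + F.2) ∧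
      -(F.1 + F.2) < 2 * s.2 ∧ 2 * s.2 < F.1 + F.2 := by
  simp only [board, Set.mem_ofPred_eq, abs_lt]

theorem exists_two_directions {p q : ℤ} (hq : p < q) (s : Square) :
    ∃ i j : Fin 8, ∀ d, s + dirVec p q d ∈ board (p, q) → d = i ∨ d = j := by
  have table : ∀ low₁ high₁ low₂ high₂ : Bool, ¬ (low₁ ∧ high₁) → ¬ (low₂ ∧ high₂) →
      ∃ i j : Fin 8, ∀ d, ![low₁ && !high₂, !high₁ && low₂, !low₁ && low₂, high₁ && !high₂,
        high₁ && !low₂, !low₁ && high₂, !high₁ && high₂, low₁ && !low₂] d → d = i ∨ d = j := by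
    decide
  obtain ⟨i, j, h⟩ := table (decide (2 * s.1 < p - q)) (decide (q - p < 2 * s.1))
    (decide (2 * s.2 < p - q)) (decide (q - p < 2 * s.2)) (by simp; omega) (by simp; omega)
  refine ⟨i, j, fun d hd => h d ?_⟩
  rw [mem_board_iff] at hd
  clear h table
  fin_cases d <;> simp [dirVec] at hd ⊢ <;> omega

variable {p q : ℤ}

theorem encard_neighborSet_inter_board_le (hp : 0 < p) (hq : p < q) (s : Square) :
    ((leaperGraph p q).neighborSet s ∩ board (p, q)).encard ≤ 2 := by
  obtain ⟨i, j, h⟩ := exists_two_directions hq s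
  have subset : (leaperGraph p q).neighborSet s ∩ board (p, q) ⊆
      {s + dirVec p q i, s + dirVec p q j} := by
    rintro t ⟨adj, ht⟩
    obtain ⟨d, rfl⟩ := (leaperGraph_adj_iff hp hq).1 adj
    rcases h d ht with rfl | rfl <;> simp
  refine (Set.encard_le_encard subset).trans ((Set.encard_insert_le _ _).trans ?_)
  rw [Set.encard_singleton, one_add_one_eq_two]

theorem IsCycle.eq_of_mem (hp : 0 < p) (hq : p < q) {C C' : (leaperGraph p q).Subgraph}
    (hC : IsCycle C) (hC' : IsCycle C') (hb : C.verts ⊆ board (p, q))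
    (hb' : C'.verts ⊆ board (p, q)) {x : Square} (hx : x ∈ C.verts) (hx' : x ∈ C'.verts) :
    C = C' := by
  obtain ⟨a, w, hw, rfl⟩ := hC
  obtain ⟨b, w', hw', rfl⟩ := hC'
  simp only [Set.subset_def, SimpleGraph.Walk.mem_verts_toSubgraph] at hb hb' hx hx'
  have sparse := encard_neighborSet_inter_board_le hp hq
  exact (toSubgraph_le_of_isCycle sparse hw' hb hb' hx hx').antisymm
    (toSubgraph_le_of_isCycle sparse hw hb' hb hx' hx)

end Board

section Frames

theorem isSkewBasic_liftFrame (t : Letter) {F : ℤ × ℤ} (h : IsSkewBasic F.1 F.2) :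
    IsSkewBasic (liftFrame t F).1 (liftFrame t F).2 := by
  obtain ⟨m, n⟩ := F
  obtain ⟨pos, lt, ⟨k, odd⟩, ⟨a, b, bezout⟩⟩ := h
  cases t <;> dsimp only [liftFrame] at *
  · exact ⟨pos, by omega, ⟨k + m, by omega⟩, a - 2 * b, b, by linear_combination bezout⟩
  · exact ⟨by omega, by omega, ⟨k + n - m, by omega⟩, b + 2 * a, -a,
      by linear_combination bezout⟩
  · exact ⟨by omega, by omega, ⟨k + n, by omega⟩, b - 2 * a, a, by linear_combination bezout⟩

theorem isSkewBasic_one_two : IsSkewBasic 1 2 := ⟨by decide, by decide, by decide, 1, 0, by decide⟩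

theorem isSkewBasic_liftFrameSeq (e : List Letter) {F : ℤ × ℤ} (h : IsSkewBasic F.1 F.2) :
    IsSkewBasic (liftFrameSeq e F).1 (liftFrameSeq e F).2 := by
  induction e with
  | nil => exact h
  | cons t e ih => exact isSkewBasic_liftFrame t ih

variable {F : ℤ × ℤ} {c d x : ℤ}

theorem inBand_zero : InBand F 0 x ↔ F.1 - F.2 < 2 * x ∧ 2 * x < F.2 - F.1 := by
  simp only [InBand, if_true, abs_lt, neg_sub]

theorem inBand_one : InBand F 1 x ↔ F.2 - F.1 < 2 * x ∧ 2 * x < F.1 + F.2 := by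
  simp [InBand]

theorem inBand_neg_one : InBand F (-1) x ↔ F.2 - F.1 < 2 * (-x) ∧ 2 * (-x) < F.1 + F.2 := by
  simp [InBand]

/-- `c` is a coordinate of a compass direction. -/
abbrev IsSign (c : ℤ) : Prop := c = 0 ∨ c = 1 ∨ c = -1

theorem isSign_compass_fst (i : Fin 8) : IsSign (compass i).1 := by revert i; decide

theorem isSign_compass_snd (i : Fin 8) : IsSign (compass i).2 := by revert i; decide

theorem InBand.sign_unique (hlt : F.1 < F.2) (hc : IsSign c) (hd : IsSign d) (h : InBand F c x)
    (h' : InBand F d x) : c = d := by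
  rcases hc with rfl | rfl | rfl <;> rcases hd with rfl | rfl | rfl <;>
    simp only [inBand_zero, inBand_one, inBand_neg_one] at h h' ⊢ <;> omega

theorem InBand.bounds (hpos : 0 < F.1) (hlt : F.1 < F.2) (hc : IsSign c) (h : InBand F c x) :
    -(F.1 + F.2) < 2 * x ∧ 2 * x < F.1 + F.2 := by
  rcases hc with rfl | rfl | rfl <;>
    simp only [inBand_zero, inBand_one, inBand_neg_one] at h <;> omega

theorem frameSection_injective (hlt : F.1 < F.2) {s : Square} {i j : Fin 8}
    (hi : s ∈ frameSection F i) (hj : s ∈ frameSection F j) : i = j := by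
  have compass_injective : Function.Injective compass := by decide
  exact compass_injective (Prod.ext
    (hi.1.sign_unique hlt (isSign_compass_fst i) (isSign_compass_fst j) hj.1)
    (hi.2.sign_unique hlt (isSign_compass_snd i) (isSign_compass_snd j) hj.2))

theorem frameSection_subset_board (hpos : 0 < F.1) (hlt : F.1 < F.2) (i : Fin 8) :
    frameSection F i ⊆ board F :=
  fun _ hs => mem_board_iff.2
    ⟨hs.1.bounds hpos hlt (isSign_compass_fst i), hs.2.bounds hpos hlt (isSign_compass_snd i)⟩

/-- Whether the lifting translation of type `t` in a direction of sign `d` carries a coordinate in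
the band of sign `c` of a frame into the band of sign `d` of the lifted frame; `side` tells the
side directions from the corner directions. -/
def liftsBand (t : Letter) (side : Bool) (d c : ℤ) : Bool :=
  let d' := if side then -d else d
  match t with
  | .f => d = 0 || c = d'
  | .g => if d = 0 then c = 0 else c ≠ d'
  | .h => d = 0 || c ≠ -d'

theorem inBand_liftFrame_iff (hpos : 0 < F.1) (hlt : F.1 < F.2) (t : Letter) (side : Bool)
    (hd : IsSign d) (hc : IsSign c) (hx : InBand F c x) :
    InBand (liftFrame t F) d
        (x + (if side then (liftLengths t F).1 else (liftLengths t F).2) * d) ↔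
      liftsBand t side d c := by
  rcases hc with rfl | rfl | rfl <;> rcases hd with rfl | rfl | rfl <;>
    simp only [inBand_zero, inBand_one, inBand_neg_one] at hx ⊢ <;>
    cases t <;> cases side <;> simp [liftsBand, liftFrame, liftLengths] <;> omega

theorem add_liftVector_mem_iff (hpos : 0 < F.1) (hlt : F.1 < F.2) (t : Letter) {s : Square}
    {j : Fin 8} (hs : s ∈ frameSection F j) (i : Fin 8) :
    s + liftVector t F i ∈ frameSection (liftFrame t F) i ↔
      i ∈ (liftTypePos t j).map Prod.fst := by
  have table : (liftsBand t (i.val % 2 = 0) (compass i).1 (compass j).1 ∧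
      liftsBand t (i.val % 2 = 0) (compass i).2 (compass j).2) ↔
        i ∈ (liftTypePos t j).map Prod.fst := by
    clear hs
    cases t <;> revert i j <;> decide
  rw [← table,
    ← inBand_liftFrame_iff hpos hlt t _ (isSign_compass_fst i) (isSign_compass_fst j) hs.1,
    ← inBand_liftFrame_iff hpos hlt t _ (isSign_compass_snd i) (isSign_compass_snd j) hs.2]
  simp only [decide_eq_true_eq]
  rfl

end Frames

/-! ### Cycles of given descent -/

section LabelledCycles

/-- The consecutive vertices, with their types, to which a vertex is lifted by `t`. -/
def liftLabelled (t : Letter) (F : ℤ × ℤ) (x : Square × VertexType) :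
    List (Square × VertexType) :=
  (liftType t x.2).map fun σ => (x.1 + liftVector t F σ.1, σ)

/-- The lift by `e` of a cycle given by the list of its vertices with their types. -/
def liftLabelledSeq : List Letter → ℤ × ℤ → List (Square × VertexType) →
    List (Square × VertexType)
  | [], _, l => l
  | t :: e, F, l => (liftLabelledSeq e F l).flatMap (liftLabelled t (liftFrameSeq e F))

/-- The move from `x` to `y` agrees with the types of both vertices. -/
def Precedes (F : ℤ × ℤ) (x y : Square × VertexType) : Prop :=
  y.1 = x.1 + dirVec F.1 F.2 (outDir x.2) ∧ inDir y.2 = outDir x.2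

/-- A cycle of the `F`-leaper within the frame `F`, given by the list of its vertices with their
types. -/
structure IsLabelledCycle (F : ℤ × ℤ) (l : List (Square × VertexType)) : Prop where
  three_le_length : 3 ≤ l.length
  mem_section : ∀ x ∈ l, x.1 ∈ frameSection F x.2.1
  nodup : (l.map Prod.fst).Nodup
  chain : (l ++ l).IsChain (Precedes F)

theorem liftType_ne_nil (t : Letter) (τ : VertexType) : liftType t τ ≠ [] := by
  cases t <;> revert τ <;> decide

theorem map_fst_liftType_perm (t : Letter) (τ : VertexType) :
    ((liftType t τ).map Prod.fst).Perm ((liftTypePos t τ.1).map Prod.fst) := by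
  cases t <;> revert τ <;> decide

theorem nodup_map_fst_liftType (t : Letter) (τ : VertexType) :
    ((liftType t τ).map Prod.fst).Nodup := by
  cases t <;> revert τ <;> decide

theorem isChain_liftLabelled (t : Letter) (F : ℤ × ℤ) (x : Square × VertexType) :
    (liftLabelled t F x).IsChain (Precedes (liftFrame t F)) := by
  obtain ⟨⟨a, b⟩, i, c⟩ := x
  obtain ⟨m, n⟩ := F
  cases t <;> fin_cases i <;> cases c <;>
    simp [liftLabelled, liftType, liftTypePos, Precedes, outDir, inDir, dirVec, liftFrame,
      liftVector, liftLengths, compass, -zsmul_eq_mul] <;> omega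

theorem eq_or_eq_of_inDir_eq {τ σ : VertexType} (h : inDir σ = outDir τ) :
    σ = (outDir τ, true) ∨ σ = (outDir τ + 1, false) := by
  rw [← h]
  clear h
  revert σ
  decide

theorem Precedes.getLast?_head? (t : Letter) {F : ℤ × ℤ} {x y : Square × VertexType}
    (h : Precedes F x y) : ∀ x' ∈ (liftLabelled t F x).getLast?,
      ∀ y' ∈ (liftLabelled t F y).head?, Precedes (liftFrame t F) x' y' := by
  obtain ⟨⟨a, b⟩, i, c⟩ := x
  obtain ⟨y, σ⟩ := y
  obtain ⟨m, n⟩ := F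
  obtain ⟨rfl : y = _, dir⟩ := h
  rcases eq_or_eq_of_inDir_eq dir with rfl | rfl <;> clear dir <;>
  cases t <;> fin_cases i <;> cases c <;>
    simp [liftLabelled, liftType, liftTypePos, Precedes, outDir, inDir, dirVec, liftFrame,
      liftVector, liftLengths, compass, -zsmul_eq_mul] <;> omega

theorem length_le_length_flatMap_liftLabelled (t : Letter) (F : ℤ × ℤ)
    (l : List (Square × VertexType)) :
    l.length ≤ (l.flatMap (liftLabelled t F)).length := by
  rw [List.length_flatMap, ← List.length_map (liftLabelled t F · |>.length)]
  refine List.length_le_sum_of_one_le _ fun n hn => ?_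
  obtain ⟨x, -, rfl⟩ := List.mem_map.1 hn
  rw [liftLabelled, List.length_map]
  exact List.length_pos_iff.2 (liftType_ne_nil t x.2)

namespace IsLabelledCycle

variable {F : ℤ × ℤ} {l : List (Square × VertexType)}

theorem add_liftVector_mem_iff (h : IsLabelledCycle F l) (hF : IsSkewBasic F.1 F.2) (t : Letter)
    {x : Square × VertexType} (hx : x ∈ l) (i : Fin 8) :
    x.1 + liftVector t F i ∈ frameSection (liftFrame t F) i ↔
      i ∈ (liftType t x.2).map Prod.fst := by
  rw [(map_fst_liftType_perm t x.2).mem_iff]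
  exact Leaper.add_liftVector_mem_iff hF.pos hF.lt t (h.mem_section x hx) i

theorem mem_section_lift (h : IsLabelledCycle F l) (hF : IsSkewBasic F.1 F.2) (t : Letter) :
    ∀ y ∈ l.flatMap (liftLabelled t F), y.1 ∈ frameSection (liftFrame t F) y.2.1 := by
  intro y hy
  obtain ⟨x, hx, hy⟩ := List.mem_flatMap.1 hy
  obtain ⟨σ, hσ, rfl⟩ := List.mem_map.1 hy
  exact (h.add_liftVector_mem_iff hF t hx σ.1).2 (List.mem_map_of_mem hσ)

theorem nodup_lift (h : IsLabelledCycle F l) (hF : IsSkewBasic F.1 F.2) (t : Letter) :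
    ((l.flatMap (liftLabelled t F)).map Prod.fst).Nodup := by
  have hlt := (isSkewBasic_liftFrame t hF).lt
  have mem {x} (hx : x ∈ l) {σ} (hσ : σ ∈ liftType t x.2) :=
    (h.add_liftVector_mem_iff hF t hx σ.1).2 (List.mem_map_of_mem hσ)
  rw [List.map_flatMap, List.nodup_flatMap]
  refine ⟨fun x hx => ?_, (List.pairwise_map.1 h.nodup).imp_of_mem fun {x x'} hx hx' hne => ?_⟩
  · rw [liftLabelled, List.map_map]
    have hn := nodup_map_fst_liftType t x.2
    refine (List.Nodup.of_map _ hn).map_on fun σ hσ σ' hσ' heq => ?_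
    have hs := mem hx hσ
    rw [show x.1 + liftVector t F σ.1 = x.1 + liftVector t F σ'.1 from heq] at hs
    exact List.inj_on_of_nodup_map hn hσ hσ' (frameSection_injective hlt hs (mem hx hσ'))
  · simp only [Function.onFun, List.Disjoint, liftLabelled, List.map_map, List.mem_map,
      Function.comp_apply]
    rintro _ ⟨σ, hσ, rfl⟩ ⟨σ', hσ', heq⟩
    have hs := mem hx hσ
    rw [← heq] at hs
    rw [frameSection_injective hlt hs (mem hx' hσ')] at heq
    exact hne (add_right_cancel heq).symm

theorem isChain_lift (h : IsLabelledCycle F l) (t : Letter) :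
    (l.flatMap (liftLabelled t F) ++ l.flatMap (liftLabelled t F)).IsChain
      (Precedes (liftFrame t F)) := by
  have nil_notMem : [] ∉ (l ++ l).map (liftLabelled t F) := fun hn => by
    obtain ⟨x, -, hx⟩ := List.mem_map.1 hn
    exact liftType_ne_nil t x.2 (List.map_eq_nil_iff.1 hx)
  rw [← List.flatMap_append, List.flatMap_def, List.isChain_flatten nil_notMem, List.isChain_map]
  refine ⟨fun l' hl' => ?_, h.chain.imp fun _ _ hxy => hxy.getLast?_head? t⟩
  obtain ⟨x, -, rfl⟩ := List.mem_map.1 hl'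
  exact isChain_liftLabelled t F x

theorem lift (h : IsLabelledCycle F l) (hF : IsSkewBasic F.1 F.2) (t : Letter) :
    IsLabelledCycle (liftFrame t F) (l.flatMap (liftLabelled t F)) where
  three_le_length := h.three_le_length.trans (length_le_length_flatMap_liftLabelled t F l)
  mem_section := h.mem_section_lift hF t
  nodup := h.nodup_lift hF t
  chain := h.isChain_lift t

theorem liftSeq (h : IsLabelledCycle F l) (hF : IsSkewBasic F.1 F.2) (e : List Letter) :
    IsLabelledCycle (liftFrameSeq e F) (liftLabelledSeq e F l) := by
  induction e with
  | nil => exact h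
  | cons t e ih => exact ih.lift (isSkewBasic_liftFrameSeq e hF) t

theorem ne_nil (h : IsLabelledCycle F l) : l ≠ [] :=
  List.ne_nil_of_length_pos (three_pos.trans_le h.three_le_length)

theorem follows (h : IsLabelledCycle F l) :
    Follows (dirVec F.1 F.2) (l.map Prod.fst) ((l.map Prod.snd).map outDir) where
  length_eq := by simp only [List.length_map]
  step k := by
    rw [List.map_map]
    simp only [cyc_map _ h.ne_nil]
    exact ((isChain_append_self_iff h.ne_nil).1 h.chain k).1

theorem map_fst_lift (h : IsLabelledCycle F l) (hF : IsSkewBasic F.1 F.2) (t : Letter) :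
    {s | s ∈ (l.flatMap (liftLabelled t F)).map Prod.fst} =
      liftSet t F {s | s ∈ l.map Prod.fst} := by
  ext y
  simp only [liftSet, liftLabelled, List.map_flatMap, List.map_map, List.mem_flatMap,
    Set.mem_ofPred_eq, List.mem_map, Function.comp_apply, Set.mem_iUnion, Set.mem_inter_iff,
    Set.mem_image]
  constructor
  · rintro ⟨x, hx, σ, hσ, rfl⟩
    exact ⟨σ.1, ⟨_, ⟨x, hx, rfl⟩, rfl⟩,
      (h.add_liftVector_mem_iff hF t hx σ.1).2 (List.mem_map_of_mem hσ)⟩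
  · rintro ⟨i, ⟨_, ⟨x, hx, rfl⟩, rfl⟩, hi⟩
    obtain ⟨σ, hσ, rfl⟩ := List.mem_map.1 ((h.add_liftVector_mem_iff hF t hx i).1 hi)
    exact ⟨x, hx, σ, hσ, rfl⟩

theorem map_fst_liftSeq (h : IsLabelledCycle F l) (hF : IsSkewBasic F.1 F.2) (e : List Letter) :
    {s | s ∈ (liftLabelledSeq e F l).map Prod.fst} =
      liftSetSeq e F {s | s ∈ l.map Prod.fst} := by
  induction e with
  | nil => rfl
  | cons t e ih =>
    rw [liftSetSeq, ← ih]
    exact (h.liftSeq hF e).map_fst_lift (isSkewBasic_liftFrameSeq e hF) t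

end IsLabelledCycle

theorem map_snd_liftLabelledSeq (e : List Letter) (F : ℤ × ℤ) (l : List (Square × VertexType)) :
    (liftLabelledSeq e F l).map Prod.snd = (l.map Prod.snd).flatMap (liftTypeSeq e) := by
  induction e with
  | nil => simp only [liftLabelledSeq, liftTypeSeq, List.flatMap_singleton']
  | cons t e ih =>
    simp only [liftLabelledSeq, liftTypeSeq]
    rw [← List.flatMap_assoc, ← ih, List.map_flatMap, List.flatMap_map]
    refine List.flatMap_congr fun x _ => ?_
    simp only [liftLabelled, List.map_map, Function.comp_def, List.map_id']

end LabelledCycles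

section ShellCycles

/-- The centre of the square subboard of the shell in section `i`. -/
def shellCenter (F : ℤ × ℤ) (i : Fin 8) : Square :=
  (if i.val % 2 = 0 then F.2 - F.1 else F.1) • compass i

/-- The shell cycle through the squares at displacement `d` from the centres of the eight subboards,
as a list of vertices with their types. -/
def shellLabelled (F : ℤ × ℤ) (d : Square) : List (Square × VertexType) :=
  ((arc 7 7).map shellType).map fun τ => (shellCenter F τ.1 + d, τ)

variable {F : ℤ × ℤ} {d : Square}

theorem isLabelledCycle_shellLabelled (hF : F.1 < F.2)
    (h : ∀ i, shellCenter F i + d ∈ frameSection F i) :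
    IsLabelledCycle F (shellLabelled F d) where
  three_le_length := by simp [shellLabelled, arc]
  mem_section x hx := by
    obtain ⟨τ, -, rfl⟩ := List.mem_map.1 hx
    exact h τ.1
  nodup := by
    rw [shellLabelled, List.map_map]
    have hn : (((arc 7 7).map shellType).map Prod.fst).Nodup := by decide
    refine (List.Nodup.of_map _ hn).map_on fun σ hσ σ' hσ' heq => ?_
    have hs := h σ.1
    rw [show shellCenter F σ.1 + d = shellCenter F σ'.1 + d from heq] at hs
    exact List.inj_on_of_nodup_map hn hσ hσ' (frameSection_injective hF hs (h σ'.1))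
  chain := by
    obtain ⟨a, b⟩ := d
    obtain ⟨m, n⟩ := F
    simp [shellLabelled, arc, shellType, Precedes, shellCenter, compass, dirVec, outDir, inDir,
      -zsmul_eq_mul]
    omega

theorem map_fst_shellLabelled (F : ℤ × ℤ) (d : Square) :
    {s | s ∈ (shellLabelled F d).map Prod.fst} = Set.range fun i => shellCenter F i + d := by
  have mem_types (i : Fin 8) : (i, true) ∈ (arc 7 7).map shellType := by revert i; decide
  ext s
  simp only [shellLabelled, List.mem_map (f := Prod.fst), List.mem_map (l := List.map _ _),
    Set.mem_ofPred_eq, Set.mem_range]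
  constructor
  · rintro ⟨_, ⟨τ, -, rfl⟩, rfl⟩
    exact ⟨τ.1, rfl⟩
  · rintro ⟨i, rfl⟩
    exact ⟨_, ⟨(i, true), mem_types i, rfl⟩, rfl⟩

theorem exists_follows_firstWord (e : List Letter) (hF : IsSkewBasic F.1 F.2)
    (h : ∀ i, shellCenter F i + d ∈ frameSection F i) :
    ∃ (l : List Square) (C : (leaperGraph (liftFrameSeq e F).1 (liftFrameSeq e F).2).Subgraph),
      IsCycleThrough l C ∧
      Follows (dirVec (liftFrameSeq e F).1 (liftFrameSeq e F).2) l (firstWord e) ∧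
      C.verts = liftSetSeq e F (Set.range fun i => shellCenter F i + d) ∧
      C.verts ⊆ board (liftFrameSeq e F) := by
  have hshell := isLabelledCycle_shellLabelled hF.lt h
  have hcycle := hshell.liftSeq hF e
  have hG := isSkewBasic_liftFrameSeq e hF
  obtain ⟨C, hC⟩ := exists_isCycleThrough hcycle.nodup
    (hcycle.three_le_length.trans_eq (List.length_map _).symm)
    fun k => (leaperGraph_adj_iff hG.pos hG.lt).2 ⟨_, hcycle.follows.step k⟩
  have verts : C.verts = {s | s ∈ (liftLabelledSeq e F (shellLabelled F d)).map Prod.fst} :=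
    Set.ext fun x => hC.mem_verts
  have types : (shellLabelled F d).map Prod.snd = (arc 7 7).map shellType := by
    simp only [shellLabelled, List.map_map, Function.comp_def]
  refine ⟨_, C, hC, ?_, ?_, ?_⟩
  · have hfollows := hcycle.follows
    rwa [map_snd_liftLabelledSeq, types] at hfollows
  · rw [verts, hshell.map_fst_liftSeq hF e, map_fst_shellLabelled]
  · rw [verts]
    intro s hs
    obtain ⟨x, hx, rfl⟩ := List.mem_map.1 hs
    exact frameSection_subset_board hG.pos hG.lt _ (hcycle.mem_section x hx)

theorem shellCenter_add_mem (hF : F.1 < F.2) (hd₁ : |2 * d.1| < shellSize F)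
    (hd₂ : |2 * d.2| < shellSize F) (i : Fin 8) : shellCenter F i + d ∈ frameSection F i := by
  obtain ⟨m, n⟩ := F
  obtain ⟨a, b⟩ := d
  rw [abs_lt] at hd₁ hd₂
  simp only [shellSize] at hF hd₁ hd₂
  split_ifs at hd₁ hd₂ <;> fin_cases i <;>
    simp [frameSection, inBand_zero, inBand_one, inBand_neg_one, compass, shellCenter,
      -zsmul_eq_mul] <;> omega

theorem mem_shell_iff {s : Square} : s ∈ shell F ↔
    ∃ i, |2 * (s - shellCenter F i).1| < shellSize F ∧
      |2 * (s - shellCenter F i).2| < shellSize F :=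
  Iff.rfl

theorem exists_add_eq_of_mem_shell (hF : F.1 < F.2) {s : Square} (hs : s ∈ shell F) :
    ∃ d, (∃ i, shellCenter F i + d = s) ∧ ∀ i, shellCenter F i + d ∈ frameSection F i := by
  obtain ⟨i, h₁, h₂⟩ := mem_shell_iff.1 hs
  exact ⟨s - shellCenter F i, ⟨i, add_sub_cancel _ _⟩, shellCenter_add_mem hF h₁ h₂⟩

theorem shell_subset_board (hpos : 0 < F.1) (hlt : F.1 < F.2) : shell F ⊆ board F := by
  intro s hs
  obtain ⟨d, ⟨i, rfl⟩, hd⟩ := exists_add_eq_of_mem_shell hlt hs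
  exact frameSection_subset_board hpos hlt i (hd i)

theorem IsShellCycle.exists_verts_eq (hF : IsSkewBasic F.1 F.2)
    {C : (leaperGraph F.1 F.2).Subgraph} (hC : IsShellCycle F C) :
    ∃ d, C.verts = Set.range (fun i => shellCenter F i + d) ∧
      ∀ i, shellCenter F i + d ∈ frameSection F i := by
  obtain ⟨l, hl⟩ := hC.1.exists_isCycleThrough
  have hx : l.head hl.ne_nil ∈ C.verts := hl.mem_verts.2 (List.head_mem _)
  obtain ⟨d, hd, mem_section⟩ := exists_add_eq_of_mem_shell hF.lt (hC.2 hx)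
  obtain ⟨l', C', hC', -, verts, onBoard⟩ := exists_follows_firstWord [] hF mem_section
  obtain rfl : C = C' := hC.1.eq_of_mem hF.pos hF.lt hC'.isCycle
    (hC.2.trans (shell_subset_board hF.pos hF.lt)) onBoard hx (verts ▸ hd)
  exact ⟨d, verts, mem_section⟩

end ShellCycles

section CyclesOfDescent

theorem liftFrameSeq_append (e e' : List Letter) (F : ℤ × ℤ) :
    liftFrameSeq (e ++ e') F = liftFrameSeq e (liftFrameSeq e' F) :=
  List.foldr_append

variable {e rest : List Letter} {p q : ℤ} {C : (leaperGraph p q).Subgraph}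
  {C₀ : (leaperGraph (liftFrameSeq rest (1, 2)).1 (liftFrameSeq rest (1, 2)).2).Subgraph}

theorem IsCycleFromShell.liftFrameSeq_eq (h : IsCycleFromShell e rest p q C C₀) :
    liftFrameSeq e (liftFrameSeq rest (1, 2)) = (p, q) :=
  (liftFrameSeq_append e rest _).symm.trans h.leaperDescent

theorem IsCycleFromShell.exists_verts_eq (h : IsCycleFromShell e rest p q C C₀) :
    ∃ d, C₀.verts = Set.range (fun i => shellCenter (liftFrameSeq rest (1, 2)) i + d) ∧
      ∀ i, shellCenter (liftFrameSeq rest (1, 2)) i + d ∈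
        frameSection (liftFrameSeq rest (1, 2)) i :=
  h.shellCycle.exists_verts_eq (isSkewBasic_liftFrameSeq rest isSkewBasic_one_two)

theorem IsCycleFromShell.exists_follows (h : IsCycleFromShell e rest p q C C₀) :
    ∃ l, IsCycleThrough l C ∧ Follows (dirVec p q) l (firstWord e) := by
  obtain ⟨d, verts, hd⟩ := h.exists_verts_eq
  obtain ⟨l, C', hC', hfollows, verts', onBoard⟩ :=
    exists_follows_firstWord e (isSkewBasic_liftFrameSeq rest isSkewBasic_one_two) hd
  obtain ⟨rfl, rfl⟩ := Prod.ext_iff.1 h.liftFrameSeq_eq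
  rw [← verts, ← h.lift] at verts'
  have hx : l.head hC'.ne_nil ∈ C'.verts := hC'.mem_verts.2 (List.head_mem _)
  obtain rfl : C = C' := h.cycle.eq_of_mem h.skewBasic.pos h.skewBasic.lt hC'.isCycle h.onBoard
    onBoard (verts' ▸ hx) hx
  exact ⟨l, hC', hfollows⟩

end CyclesOfDescent

/-! ### Canonical second leaper cycles -/

section Paths

/-- The list `l` is a path from `s` to `t` that follows the word `w`, the letter `i` standing for
the translation `v i`. -/
inductive IsPathAlong {ι A : Type*} [Add A] (v : ι → A) : A → List ι → List A → A → Prop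
  | nil (s : A) : IsPathAlong v s [] [s] s
  | cons {s t : A} {k : ι} {w : List ι} {l : List A} (h : IsPathAlong v (s + v k) w l t) :
      IsPathAlong v s (k :: w) (s :: l) t

namespace IsPathAlong

variable {ι A : Type*} [AddCommGroup A] {v : ι → A} {s t x : A} {k : ι} {u w : List ι}
  {l m : List A}

theorem append (h : IsPathAlong v s u l t) (h' : IsPathAlong v (t + v k) w m x) :
    IsPathAlong v s (u ++ k :: w) (l ++ m) x := by
  induction h with
  | nil s => exact h'.cons
  | cons _ ih => exact (ih h').cons

theorem add_right (h : IsPathAlong v s w l t) (d : A) :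
    IsPathAlong v (s + d) w (l.map (· + d)) (t + d) := by
  induction h with
  | nil s => exact nil _
  | cons _ ih => exact cons (by rwa [add_right_comm])

theorem length_eq (h : IsPathAlong v s w l t) : l.length = w.length + 1 := by
  induction h with
  | nil s => rfl
  | cons _ ih => rw [List.length_cons, List.length_cons, ih]

theorem getElem_zero (h : IsPathAlong v s w l t) (hl : 0 < l.length) : l[0] = s := by
  cases h <;> rfl

theorem getElem_length (h : IsPathAlong v s w l t) (hl : w.length < l.length) :
    l[w.length] = t := by
  induction h with
  | nil s => rfl
  | cons _ ih => exact ih _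

theorem getElem_succ (h : IsPathAlong v s w l t) {n : ℕ} (hn : n < w.length)
    (hl : n + 1 < l.length) : l[n + 1] = l[n] + v w[n] := by
  induction h generalizing n with
  | nil s => exact absurd hn (Nat.not_lt_zero _)
  | cons h ih =>
    cases n with
    | zero => exact h.getElem_zero _
    | succ n => exact ih (Nat.lt_of_succ_lt_succ hn) (Nat.lt_of_succ_lt_succ hl)

theorem follows [Inhabited ι] [Inhabited A] (h : IsPathAlong v s w l t) (closed : t + v k = s) :
    Follows v l (w ++ [k]) where
  length_eq := by rw [h.length_eq, List.length_append, List.length_singleton]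
  step j := by
    have length_eq := h.length_eq
    have length_word : (w ++ [k]).length = l.length := by simp [length_eq]
    rw [← cyc_mod (l := l) j, ← cyc_mod (l := w ++ [k]) j, length_word]
    have hj : j % l.length < l.length := Nat.mod_lt _ (by omega)
    rw [cyc_congr (l := l) ((Nat.mod_modEq j l.length).symm.add_right 1)]
    generalize j % l.length = j at hj
    rw [cyc_of_lt hj, cyc_of_lt (l := w ++ [k]) (by rwa [length_word])]
    rcases Nat.lt_succ_iff_lt_or_eq.1 (length_eq ▸ hj) with hlt | rfl
    · rw [cyc_of_lt (by omega), h.getElem_succ hlt, List.getElem_append_left]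
    · rw [h.getElem_length, cyc_congr (l := l) (k := 0) (by rw [← length_eq]; simp [Nat.ModEq]),
        cyc_of_lt (by omega), h.getElem_zero, List.getElem_concat_length rfl, closed]

theorem reverse {v : Fin 8 → A} {w : List (Fin 8)} (h : IsPathAlong v s w l t)
    (hv : ∀ k, v (k + 4) = -v k) : IsPathAlong v t (reverseWord w) l.reverse s := by
  induction h with
  | nil s => exact nil s
  | cons _ ih =>
    rw [reverseWord, List.map_cons, List.reverse_cons, List.reverse_cons]
    refine ih.append ?_
    rw [hv, add_neg_cancel_right]
    exact nil _

end IsPathAlong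

theorem Follows.map {ι κ A : Type*} [Inhabited ι] [Inhabited κ] [Inhabited A] [AddGroup A]
    {f : ι → κ} {v : κ → A} {l : List A} {w : List ι} (h : Follows (v ∘ f) l w) (hl : l ≠ []) :
    Follows v l (w.map f) where
  length_eq := by rw [List.length_map, h.length_eq]
  step k := by
    have hw : w ≠ [] := List.ne_nil_of_length_pos (h.length_eq ▸ List.length_pos_iff.2 hl)
    rw [cyc_map f hw, h.step, Function.comp_apply]

end Paths

section ProperWalks

/-- The family `a` of paths, with endpoints `s i` and `t i`, forms a closed walk with words `U`
within the sections and directions `X` between them, and satisfies the condition on the endpoints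
imposed on proper cycles. -/
structure IsProperWalk (v : Fin 8 → Square) (F : ℤ × ℤ) (U : Fin 8 → List (Fin 8))
    (X : Fin 8 → Fin 8) (a : Fin 8 → List Square) (s t : Fin 8 → Square) : Prop where
  path : ∀ i, IsPathAlong v (s i) (U i) (a i) (t i)
  junction : ∀ i, t i + v (X i) = s (i + 1)
  proper : ∀ i, s i + properVector F i = t (i + 5)

/-- The sections whose paths are united in section `i` of the lift by `t`. -/
def liftArc (t : Letter) (i : Fin 8) : List (Fin 8) :=
  if t.Reverses i then arc (2 * (t.radius + 1)) (i + 4 - (t.radius + 1 : ℕ))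
  else arc (2 * t.radius) (i - t.radius)

theorem mem_liftArc {t : Letter} {i j : Fin 8} :
    j ∈ liftArc t i ↔ i ∈ (liftTypePos t j).map Prod.fst := by
  cases t <;> revert i j <;> decide

theorem nodup_liftArc (t : Letter) (i : Fin 8) : (liftArc t i).Nodup := by
  cases t <;> revert i <;> decide

theorem liftPathsAux_eq (t : Letter) (a : Fin 8 → List Square) (i : Fin 8) :
    liftPathsAux t a i =
      if t.Reverses i then ((liftArc t i).flatMap a).reverse else (liftArc t i).flatMap a := by
  cases t <;> fin_cases i <;>
    simp [liftPathsAux, liftArc, Letter.Reverses, Letter.radius, arc] <;> rfl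

theorem liftPathsAux_perm (t : Letter) (a : Fin 8 → List Square) (i : Fin 8) :
    (liftPathsAux t a i).Perm ((liftArc t i).flatMap a) := by
  rw [liftPathsAux_eq]
  split
  · exact List.reverse_perm _
  · exact List.Perm.refl _

theorem properVector_add_four (F : ℤ × ℤ) (i : Fin 8) :
    properVector F (i + 4) = -properVector F i := by
  obtain ⟨m, n⟩ := F
  fin_cases i <;> simp [properVector]

theorem liftVector_add_properVector (t : Letter) (F : ℤ × ℤ) (i : Fin 8) :
    liftVector t F i + properVector (liftFrame t F) i = liftVector t F (i + 5) := by
  obtain ⟨m, n⟩ := F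
  cases t <;> fin_cases i <;>
    simp [liftVector, liftFrame, liftLengths, compass, properVector, -zsmul_eq_mul] <;> omega

theorem liftVector_of_reverses {t : Letter} {i : Fin 8} (hi : t.Reverses i) (F : ℤ × ℤ) :
    liftVector t F i = properVector F (i + 3 - t.radius) + liftVector t F (i + 1) := by
  obtain ⟨m, n⟩ := F
  cases t <;> fin_cases i <;> first
    | exact absurd hi (by decide)
    | simp [liftVector, liftLengths, compass, properVector, Letter.radius, -zsmul_eq_mul]
  all_goals omega

theorem liftVector_of_not_reverses {t : Letter} {i : Fin 8} (hi : ¬ t.Reverses i) (F : ℤ × ℤ) :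
    liftVector t F i = properVector F (i + t.radius + 1) + liftVector t F (i + 1) := by
  obtain ⟨m, n⟩ := F
  cases t <;> fin_cases i <;> first
    | exact absurd (by decide) hi
    | simp [liftVector, liftLengths, compass, properVector, Letter.radius, -zsmul_eq_mul]
  all_goals omega

/-- The starting square, before translation, of the path in section `i` of the lift by `t` of a
family of paths from `s i` to `e i`. -/
def liftStart (t : Letter) (s e : Fin 8 → Square) (i : Fin 8) : Square :=
  if t.Reverses i then e (i + 5 + t.radius) else s (i - t.radius)

/-- The final square, before translation, of the path in section `i` of the lift by `t` of a family
of paths from `s i` to `e i`. -/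
def liftEnd (t : Letter) (s e : Fin 8 → Square) (i : Fin 8) : Square :=
  if t.Reverses i then s (i + 3 - t.radius) else e (i + t.radius)

namespace IsProperWalk

variable {v : Fin 8 → Square} {F : ℤ × ℤ} {U : Fin 8 → List (Fin 8)} {X : Fin 8 → Fin 8}
  {a : Fin 8 → List Square} {s e : Fin 8 → Square}

theorem isPathAlong_arc (H : IsProperWalk v F U X a s e) (n : ℕ) (i : Fin 8) :
    IsPathAlong v (s i) (pathRun U X n i) ((arc n i).flatMap a) (e (i + n)) := by
  induction n generalizing i with
  | zero => simpa [pathRun, arc] using H.path i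
  | succ n ih =>
    have tail := ih (i + 1)
    rw [← H.junction i] at tail
    rw [arc, List.flatMap_cons, pathRun, Nat.cast_succ, add_comm (n : Fin 8), ← add_assoc]
    exact (H.path i).append tail

theorem isPathAlong_liftPathsAux (H : IsProperWalk v F U X a s e) (hv : ∀ k, v (k + 4) = -v k)
    (t : Letter) (i : Fin 8) :
    IsPathAlong v (liftStart t s e i) (nextWord t U X i) (liftPathsAux t a i)
      (liftEnd t s e i) := by
  rw [liftPathsAux_eq, liftArc, liftStart, liftEnd, nextWord]
  split_ifs
  · have start_index : i + 5 + t.radius =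
        i + 4 - (t.radius + 1 : ℕ) + (2 * (t.radius + 1) : ℕ) := by push_cast; ring
    have end_index : i + 3 - t.radius = i + 4 - (t.radius + 1 : ℕ) := by push_cast; ring
    rw [start_index, end_index]
    exact (H.isPathAlong_arc _ _).reverse hv
  · have end_index : i + t.radius = i - t.radius + (2 * t.radius : ℕ) := by push_cast; ring
    rw [end_index]
    exact H.isPathAlong_arc _ _

theorem junction_lift (H : IsProperWalk v F U X a s e) (t : Letter) (i : Fin 8) :
    liftEnd t s e i + liftVector t F i + v (nextJunction t X i) =
      liftStart t s e (i + 1) + liftVector t F (i + 1) := by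
  have eight_eq_zero : (8 : Fin 8) = 0 := rfl
  rw [liftEnd, liftStart, nextJunction]
  by_cases hi : t.Reverses i
  · have junction := H.junction (i - t.radius)
    have proper := H.proper (i + 3 - t.radius)
    rw [show i - t.radius + 1 = i + 1 - t.radius by ring] at junction
    rw [show i + 3 - t.radius + 5 = i - t.radius by linear_combination eight_eq_zero] at proper
    rw [if_pos hi, if_pos hi, if_neg ((t.reverses_add_one_iff i).not_left.2 hi),
      liftVector_of_reverses hi, ← junction, ← proper]
    abel
  · have junction := H.junction (i + t.radius)
    have proper := H.proper (i + t.radius + 1)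
    rw [show i + t.radius + 1 + 5 = i + 1 + 5 + t.radius by ring] at proper
    rw [if_neg hi, if_neg hi, if_pos ((t.reverses_add_one_iff i).2 hi),
      liftVector_of_not_reverses hi, ← proper, ← junction]
    abel

theorem proper_lift (t : Letter) (F : ℤ × ℤ) (s e : Fin 8 → Square) (i : Fin 8) :
    liftStart t s e i + liftVector t F i + properVector (liftFrame t F) i =
      liftEnd t s e (i + 5) + liftVector t F (i + 5) := by
  have eight_eq_zero : (8 : Fin 8) = 0 := rfl
  have start_eq : liftStart t s e i = liftEnd t s e (i + 5) := by
    have hi : t.Reverses (i + 5) ↔ ¬ t.Reverses i := by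
      rw [show i + 5 = i + 4 + 1 by ring, t.reverses_add_one_iff, t.reverses_add_iff rfl]
    rw [liftStart, liftEnd]
    by_cases h : t.Reverses i
    · rw [if_pos h, if_neg (hi.not_left.2 h)]
    · rw [if_neg h, if_pos (hi.2 h)]
      rw [show i + 5 + 3 - t.radius = i - t.radius by linear_combination eight_eq_zero]
  rw [add_assoc, liftVector_add_properVector, start_eq]

theorem lift (H : IsProperWalk v F U X a s e) (hv : ∀ k, v (k + 4) = -v k) (t : Letter) :
    IsProperWalk v (liftFrame t F) (nextWord t U X) (nextJunction t X) (liftPaths t F a)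
      (fun i => liftStart t s e i + liftVector t F i)
      (fun i => liftEnd t s e i + liftVector t F i) where
  path i := (H.isPathAlong_liftPathsAux hv t i).add_right _
  junction := H.junction_lift t
  proper := proper_lift t F s e

theorem liftSeq (H : IsProperWalk v F (fun _ => []) id a s e) (hv : ∀ k, v (k + 4) = -v k)
    (w : List Letter) : ∃ s' e', IsProperWalk v (liftFrameSeq w F) (pathWord w) (junctionLabel w)
      (liftPathsSeq w F a) s' e' := by
  induction w with
  | nil => exact ⟨s, e, H⟩
  | cons t w ih =>
    obtain ⟨s', e', H'⟩ := ih
    exact ⟨_, _, H'.lift hv t⟩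

end IsProperWalk

theorem concatPaths_eq_flatMap (a : Fin 8 → List Square) :
    concatPaths a = (arc 7 0).flatMap a := by
  rw [List.flatMap_def]
  rfl

theorem secondWord_eq_pathRun (e : List Letter) :
    secondWord e = pathRun (pathWord e) (junctionLabel e) 7 0 ++ [junctionLabel e 7] := by
  simp [secondWord, pathRun, List.ofFn_succ]

theorem IsProperWalk.follows {v : Fin 8 → Square} {F : ℤ × ℤ} {a : Fin 8 → List Square}
    {s t : Fin 8 → Square} (H : IsProperWalk v F (fun _ => []) id a s t)
    (hv : ∀ k, v (k + 4) = -v k) (e : List Letter) :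
    Follows v (concatPaths (liftPathsSeq e F a)) (secondWord e) := by
  obtain ⟨_, _, lifted⟩ := H.liftSeq hv e
  rw [concatPaths_eq_flatMap, secondWord_eq_pathRun]
  exact (lifted.isPathAlong_arc 7 0).follows (lifted.junction 7)

end ProperWalks

section Sectioned

/-- The lists `a i`, each within section `i` of `F` and without repetition, exhaust the set `S`. -/
structure IsSectioned (F : ℤ × ℤ) (a : Fin 8 → List Square) (S : Set Square) : Prop where
  mem_section : ∀ i, ∀ x ∈ a i, x ∈ frameSection F i
  nodup : ∀ i, (a i).Nodup
  mem_iff : ∀ x, x ∈ S ↔ ∃ i, x ∈ a i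

theorem mem_concatPaths {a : Fin 8 → List Square} {x : Square} :
    x ∈ concatPaths a ↔ ∃ i, x ∈ a i := by
  have mem_arc : ∀ i : Fin 8, i ∈ arc 7 0 := by decide
  simp only [concatPaths_eq_flatMap, List.mem_flatMap, mem_arc, true_and]

namespace IsSectioned

variable {F : ℤ × ℤ} {a : Fin 8 → List Square} {S : Set Square}

theorem nodup_flatMap (H : IsSectioned F a S) (hF : F.1 < F.2) {l : List (Fin 8)}
    (hl : l.Nodup) : (l.flatMap a).Nodup :=
  List.nodup_flatMap.2 ⟨fun i _ => H.nodup i, hl.imp fun {i j} hij x hx hx' =>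
    hij (frameSection_injective hF (H.mem_section i x hx) (H.mem_section j x hx'))⟩

theorem nodup_concatPaths (H : IsSectioned F a S) (hF : F.1 < F.2) : (concatPaths a).Nodup := by
  rw [concatPaths_eq_flatMap]
  exact H.nodup_flatMap hF (by decide)

theorem mem_liftPathsAux_iff (H : IsSectioned F a S) (hF : IsSkewBasic F.1 F.2) (t : Letter)
    {i : Fin 8} {x : Square} : x ∈ liftPathsAux t a i ↔
      x ∈ S ∧ x + liftVector t F i ∈ frameSection (liftFrame t F) i := by
  rw [(liftPathsAux_perm t a i).mem_iff, List.mem_flatMap, H.mem_iff, ← exists_and_right]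
  refine exists_congr fun j => ?_
  rw [mem_liftArc, and_comm]
  exact and_congr_right fun hx =>
    (add_liftVector_mem_iff hF.pos hF.lt t (H.mem_section j x hx) i).symm

theorem lift (H : IsSectioned F a S) (hF : IsSkewBasic F.1 F.2) (t : Letter) :
    IsSectioned (liftFrame t F) (liftPaths t F a) (liftSet t F S) where
  mem_section i x hx := by
    obtain ⟨y, hy, rfl⟩ := List.mem_map.1 hx
    exact ((H.mem_liftPathsAux_iff hF t).1 hy).2
  nodup i := ((liftPathsAux_perm t a i).nodup_iff.2
    (H.nodup_flatMap hF.lt (nodup_liftArc t i))).map (add_left_injective _)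
  mem_iff x := by
    simp only [liftSet, Set.mem_iUnion, liftPaths, List.mem_map, H.mem_liftPathsAux_iff hF t]
    refine exists_congr fun i => ⟨?_, ?_⟩
    · rintro ⟨⟨y, hy, rfl⟩, hi⟩
      exact ⟨y, ⟨hy, hi⟩, rfl⟩
    · rintro ⟨y, ⟨hy, hi⟩, rfl⟩
      exact ⟨⟨y, hy, rfl⟩, hi⟩

theorem liftSeq (H : IsSectioned F a S) (hF : IsSkewBasic F.1 F.2) (e : List Letter) :
    IsSectioned (liftFrameSeq e F) (liftPathsSeq e F a) (liftSetSeq e F S) := by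
  induction e with
  | nil => exact H
  | cons t e ih => exact ih.lift (isSkewBasic_liftFrameSeq e hF) t

end IsSectioned

end Sectioned

section ShellPaths

/-- If the `(r, s)`-leaper moves over the squares of a shell cycle of the lift by `o` of the
`(r, s)`-frame, then its move from section `i` to section `i + 1` has direction `originPerm o i`.
The letter `f` is not an origin, and gets a junk value. -/
def originPerm : Letter → Equiv.Perm (Fin 8)
  | .h => Equiv.addRight 2
  | _ => ⟨fun k => if k.val % 2 = 0 then k + 1 else k + 3,
      fun k => if k.val % 2 = 0 then k - 3 else k - 1, by decide, by decide⟩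

theorem originPerm_add_four (o : Letter) (k : Fin 8) :
    originPerm o (k + 4) = originPerm o k + 4 := by
  cases o <;> revert k <;> decide

theorem dirVec_originPerm_add_four (p q : ℤ) (o : Letter) (k : Fin 8) :
    (dirVec p q ∘ originPerm o) (k + 4) = -(dirVec p q ∘ originPerm o) k := by
  simp only [Function.comp_apply, originPerm_add_four, dirVec_add_four]

/-- The squares at displacement `d` from the centres of the eight subboards of the shell, as eight
one-square paths. -/
def shellPaths (F : ℤ × ℤ) (d : Square) (i : Fin 8) : List Square := [shellCenter F i + d]

theorem isSectioned_shellPaths {F : ℤ × ℤ} {d : Square}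
    (h : ∀ i, shellCenter F i + d ∈ frameSection F i) :
    IsSectioned F (shellPaths F d) (Set.range fun i => shellCenter F i + d) where
  mem_section i x hx := List.mem_singleton.1 hx ▸ h i
  nodup i := List.nodup_singleton _
  mem_iff x := by simp only [shellPaths, Set.mem_range, List.mem_singleton, eq_comm]

theorem shellCenter_add_properVector (F : ℤ × ℤ) (i : Fin 8) :
    shellCenter F i + properVector F i = shellCenter F (i + 5) := by
  obtain ⟨m, n⟩ := F
  fin_cases i <;> simp [shellCenter, compass, properVector, -zsmul_eq_mul] <;> omega

theorem isProperWalk_shellPaths {o : Letter} (ho : o = .g ∨ o = .h) (r s : ℤ) (d : Square) :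
    IsProperWalk (dirVec r s ∘ originPerm o) (liftFrame o (r, s)) (fun _ => []) id
      (shellPaths (liftFrame o (r, s)) d) (fun i => shellCenter (liftFrame o (r, s)) i + d)
      (fun i => shellCenter (liftFrame o (r, s)) i + d) where
  path i := .nil _
  junction i := by
    obtain ⟨x, y⟩ := d
    rcases ho with rfl | rfl <;> fin_cases i <;>
      simp [shellCenter, liftFrame, compass, originPerm, dirVec, -zsmul_eq_mul] <;> omega
  proper i := by rw [add_right_comm, shellCenter_add_properVector]

theorem isProperCycle_shellPaths {F : ℤ × ℤ} {r s : ℤ} {d : Square}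
    {D : (leaperGraph r s).Subgraph} (hD : IsCycleThrough (concatPaths (shellPaths F d)) D)
    (hd : ∀ i, shellCenter F i + d ∈ frameSection F i) : IsProperCycle F (shellPaths F d) D where
  nonempty i := List.cons_ne_nil _ _
  within := (isSectioned_shellPaths hd).mem_section
  cycle := hD
  proper i := by
    have start_eq : shellCenter F i + d + properVector F i = shellCenter F (i + 5) + d := by
      rw [add_right_comm, shellCenter_add_properVector]
    have eight_eq_zero : (8 : Fin 8) = 0 := rfl
    have end_eq : shellCenter F (i + 1) + d + properVector F i = shellCenter F (i + 4) + d := by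
      have antipode := shellCenter_add_properVector F (i + 4)
      rw [properVector_add_four, show i + 4 + 5 = i + 1 by
        linear_combination eight_eq_zero] at antipode
      rw [← antipode]
      abel
    exact congrArg₂ (fun x y => [x, y]) start_eq end_eq

theorem IsProperCycle.eq_shellPaths {F : ℤ × ℤ} (hF : F.1 < F.2) {r s : ℤ}
    {a : Fin 8 → List Square} {D : (leaperGraph r s).Subgraph} (h : IsProperCycle F a D)
    {d : Square} (hd : ∀ i, shellCenter F i + d ∈ frameSection F i)
    (hD : D.verts = Set.range fun i => shellCenter F i + d) : a = shellPaths F d := by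
  funext i
  have all_eq : ∀ x ∈ a i, x = shellCenter F i + d := by
    intro x hx
    have hx' : x ∈ D.verts := h.cycle.mem_verts.2 (mem_concatPaths.2 ⟨i, hx⟩)
    rw [hD] at hx'
    obtain ⟨j, rfl⟩ := hx'
    rw [frameSection_injective hF (hd j) (h.within i _ hx)]
  have nodup : (a i).Nodup :=
    (List.nodup_flatten.1 h.cycle.nodup).1 _ (List.mem_ofFn.2 ⟨i, rfl⟩)
  rw [List.eq_replicate_of_mem all_eq] at nodup ⊢
  rw [le_antisymm (List.nodup_replicate.1 nodup) (List.length_pos_iff.2 (h.nonempty i))]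
  rfl

theorem IsCanonicalSecondCycle.exists_follows {e : List Letter} {o : Letter}
    (ho : o = .g ∨ o = .h) {p q r s : ℤ} {C : (leaperGraph p q).Subgraph}
    {D : (leaperGraph r s).Subgraph} (h : IsCanonicalSecondCycle e o C D) :
    IsSkewBasic r s ∧ ∃ l, IsCycleThrough l D ∧
      Follows (dirVec r s ∘ originPerm o) l (secondWord e) := by
  obtain ⟨rest, C₀, hC, hM, hrest, a, D₀, hD₀, verts₀, hD, -⟩ := h
  obtain ⟨d, verts, hsec⟩ := hC.exists_verts_eq
  have hlt := (isSkewBasic_liftFrameSeq (F := (1, 2)) (o :: rest) isSkewBasic_one_two).lt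
  obtain rfl := hD₀.eq_shellPaths hlt hsec (verts₀.trans verts)
  have frame_eq : liftFrameSeq (o :: rest) (1, 2) = liftFrame o (r, s) := congrArg _ hrest
  rw [frame_eq] at hD
  exact ⟨hM, _, hD,
    (isProperWalk_shellPaths ho r s d).follows (dirVec_originPerm_add_four r s o) e⟩

end ShellPaths

section Existence

theorem antipodal_ofAdd {A : Type*} [AddGroup A] {x : Fin 8 → A}
    (h : ∀ k, x (k + 4) = -x k) : Antipodal (Multiplicative.ofAdd ∘ x) :=
  fun k => congrArg Multiplicative.ofAdd (h k)

theorem sum_map_dirMatrix_firstWord (e : List Letter) :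
    ((firstWord e).map dirMatrix).sum = 0 := by
  rw [← ofAdd_eq_one, ofAdd_list_prod, List.map_map]
  exact prod_map_firstWord (antipodal_ofAdd dirMatrix_add_four) e

theorem sum_map_dirMatrix_secondWord (e : List Letter) (o : Letter) :
    (((secondWord e).map (originPerm o)).map dirMatrix).sum = 0 := by
  have antipodal : ∀ k, (dirMatrix ∘ originPerm o) (k + 4) = -(dirMatrix ∘ originPerm o) k :=
    fun k => by simp only [Function.comp_apply, originPerm_add_four, dirMatrix_add_four]
  rw [← ofAdd_eq_one, ofAdd_list_prod, List.map_map, List.map_map]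
  exact prod_map_secondWord (antipodal_ofAdd antipodal) e

theorem exists_isCycleFromShell (e rest : List Letter)
    (h : 0 < shellSize (liftFrameSeq rest (1, 2))) :
    ∃ (p q : ℤ) (C : (leaperGraph p q).Subgraph) (C₀ : (leaperGraph
        (liftFrameSeq rest (1, 2)).1 (liftFrameSeq rest (1, 2)).2).Subgraph),
      IsCycleFromShell e rest p q C C₀ ∧
        C₀.verts = Set.range fun i => shellCenter (liftFrameSeq rest (1, 2)) i + 0 := by
  have hF := isSkewBasic_liftFrameSeq (F := (1, 2)) rest isSkewBasic_one_two
  have centred : |2 * (0 : ℤ)| < shellSize (liftFrameSeq rest (1, 2)) := by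
    rwa [mul_zero, abs_zero]
  have inSection := shellCenter_add_mem (d := 0) hF.lt centred centred
  obtain ⟨_, C₀, hC₀, -, verts₀, -⟩ := exists_follows_firstWord [] hF inSection
  obtain ⟨_, C, hC, -, verts, onBoard⟩ := exists_follows_firstWord e hF inSection
  refine ⟨_, _, C, C₀, ⟨isSkewBasic_liftFrameSeq e hF, liftFrameSeq_append e rest _, hC.isCycle,
    onBoard, ⟨hC₀.isCycle, ?_⟩, verts.trans (congrArg _ verts₀.symm)⟩, verts₀⟩
  rw [verts₀]
  rintro _ ⟨i, rfl⟩
  simp only [add_zero]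
  exact mem_shell_iff.2 ⟨i, by rwa [sub_self], by rwa [sub_self]⟩

theorem exists_isFundamental (e : List Letter) :
    ∃ (V : Type) (Φ : DirectionGraph V), IsFundamental e Φ := by
  obtain ⟨p, q, C, C₀, hC, -⟩ := exists_isCycleFromShell e [] (by decide)
  obtain ⟨l, hl, hw⟩ := hC.exists_follows
  obtain ⟨V, Φ, hΦ⟩ := exists_isExtractedFrom hC.skewBasic.pos hC.skewBasic.lt hl hw
    (sum_map_dirMatrix_firstWord e)
  exact ⟨V, Φ, p, q, C, ⟨[], C₀, hC⟩, hΦ⟩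

theorem three_le_length_secondWord (e : List Letter) : 3 ≤ (secondWord e).length := by
  simp only [secondWord, List.ofFn_succ, List.flatten_cons, List.length_append,
    List.length_singleton]
  omega

theorem exists_isCycleThrough_liftPathsSeq {o : Letter} (ho : o = .g ∨ o = .h) {r s : ℤ}
    (hM : IsSkewBasic r s) {d : Square}
    (hd : ∀ i, shellCenter (liftFrame o (r, s)) i + d ∈ frameSection (liftFrame o (r, s)) i)
    (e : List Letter) :
    ∃ D : (leaperGraph r s).Subgraph,
      IsCycleThrough (concatPaths (liftPathsSeq e (liftFrame o (r, s))
        (shellPaths (liftFrame o (r, s)) d))) D ∧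
      D.verts = liftSetSeq e (liftFrame o (r, s))
        (Set.range fun i => shellCenter (liftFrame o (r, s)) i + d) := by
  have hF := isSkewBasic_liftFrameSeq (F := (r, s)) [o] hM
  have sectioned := (isSectioned_shellPaths hd).liftSeq hF e
  have follows := (isProperWalk_shellPaths ho r s d).follows
    (dirVec_originPerm_add_four r s o) e
  obtain ⟨D, hD⟩ := exists_isCycleThrough
    (sectioned.nodup_concatPaths (isSkewBasic_liftFrameSeq e hF).lt)
    (follows.length_eq ▸ three_le_length_secondWord e)
    fun k => (leaperGraph_adj_iff hM.pos hM.lt).2 ⟨_, follows.step k⟩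
  refine ⟨D, hD, Set.ext fun x => ?_⟩
  rw [hD.mem_verts, sectioned.mem_iff, mem_concatPaths]

theorem exists_isSecondFundamental (e : List Letter) {o : Letter} (ho : o = .g ∨ o = .h) :
    ∃ (V : Type) (Φ : DirectionGraph V), IsSecondFundamental e o Φ := by
  have shell_nonempty : 0 < shellSize (liftFrameSeq [o] (1, 2)) := by
    rcases ho with rfl | rfl <;> decide
  obtain ⟨p, q, C, C₀, hC, verts₀⟩ := exists_isCycleFromShell e [o] shell_nonempty
  have inSection := shellCenter_add_mem (d := 0)
    (isSkewBasic_liftFrameSeq (F := (1, 2)) [o] isSkewBasic_one_two).lt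
    shell_nonempty shell_nonempty
  obtain ⟨D₀, hD₀, D₀_over⟩ :=
    exists_isCycleThrough_liftPathsSeq ho isSkewBasic_one_two inSection []
  obtain ⟨D, hD, D_over⟩ := exists_isCycleThrough_liftPathsSeq ho isSkewBasic_one_two inSection e
  have canonical : IsCanonicalSecondCycle e o C D :=
    ⟨[], C₀, hC, isSkewBasic_one_two, rfl, _, D₀, isProperCycle_shellPaths hD₀ inSection,
      D₀_over.trans verts₀.symm, hD, D_over.trans ((congrArg _ verts₀.symm).trans hC.lift.symm)⟩
  obtain ⟨hM, l, hl, hw⟩ := canonical.exists_follows ho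
  obtain ⟨V, Φ, hΦ⟩ := exists_isExtractedFrom hM.pos hM.lt hl (hw.map hl.ne_nil)
    (sum_map_dirMatrix_secondWord e o)
  exact ⟨V, Φ, _, _, _, _, C, D, canonical, hΦ⟩

end Existence

section Equivalence

theorem IsFundamental.exists_isTraversal {V : Type*} {e : List Letter} {Φ : DirectionGraph V}
    (h : IsFundamental e Φ) :
    (∃ f, Φ.IsTraversal (firstWord e) f) ∧ NoBacktrack ((firstWord e).map starPerm) := by
  obtain ⟨p, q, C, ⟨rest, C₀, hC⟩, hΦ⟩ := h
  obtain ⟨l, hl, hw⟩ := hC.exists_follows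
  refine ⟨hΦ.exists_isTraversal hC.skewBasic.pos hC.skewBasic.lt hl hw, ?_⟩
  have starred : Follows (dirVec p q ∘ starPerm) l ((firstWord e).map starPerm) := by
    refine Follows.map (f := starPerm) ?_ hl.ne_nil
    have involutive : starPerm ∘ starPerm = id := by decide
    rwa [Function.comp_assoc, involutive]
  exact starred.noBacktrack (fun i => by
    simp only [Function.comp_apply, starPerm_add_four, dirVec_add_four])
    hl.nodup hl.three_le_length

theorem IsSecondFundamental.exists_isTraversal {V : Type*} {e : List Letter} {o : Letter}
    (ho : o = .g ∨ o = .h) {Φ : DirectionGraph V} (h : IsSecondFundamental e o Φ) :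
    (∃ f, Φ.IsTraversal ((secondWord e).map (originPerm o)) f) ∧ NoBacktrack (secondWord e) := by
  obtain ⟨p, q, r, s, C, D, hD, hΦ⟩ := h
  obtain ⟨hM, l, hl, hw⟩ := hD.exists_follows ho
  exact ⟨hΦ.exists_isTraversal hM.pos hM.lt hl (hw.map hl.ne_nil),
    hw.noBacktrack (dirVec_originPerm_add_four r s o) hl.nodup hl.three_le_length⟩

theorem isEquivalencePerm_of_two_smul_eq {π : Equiv.Perm (Fin 8)}
    {P Q : Matrix (Fin 2) (Fin 2) ℤ} (h : ∀ i, 2 • dirMatrix (π i) = P * dirMatrix i * Q) :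
    IsEquivalencePerm π := by
  let toReal := (Int.castRingHom ℝ).mapMatrix (m := Fin 2)
  refine ⟨toReal P, (1 / 2 : ℝ) • toReal Q, fun i => ?_⟩
  change toReal _ = toReal P * toReal _ * _
  rw [Matrix.mul_smul, ← map_mul, ← map_mul, ← h, map_nsmul, ← Nat.cast_smul_eq_nsmul ℝ,
    smul_smul]
  norm_num

theorem isEquivalencePerm_starPerm_trans_originPerm {o : Letter} (ho : o = .g ∨ o = .h) :
    IsEquivalencePerm (starPerm.trans (originPerm o)) := by
  rcases ho with rfl | rfl
  · exact isEquivalencePerm_of_two_smul_eq (P := !![-1, 1; 1, 1]) (Q := !![-1, 1; -1, -1])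
      (by decide)
  · exact isEquivalencePerm_of_two_smul_eq (P := !![-1, 1; 1, 1]) (Q := !![1, 1; 1, -1])
      (by decide)

theorem IsEquivalencePerm.trans {π ρ : Equiv.Perm (Fin 8)} (h : IsEquivalencePerm π)
    (h' : IsEquivalencePerm ρ) : IsEquivalencePerm (π.trans ρ) := by
  obtain ⟨P, Q, h⟩ := h
  obtain ⟨P', Q', h'⟩ := h'
  exact ⟨P' * P, Q * Q', fun i => by simp only [Equiv.trans_apply, h', h, Matrix.mul_assoc]⟩

theorem IsEquivalencePerm.symm {π : Equiv.Perm (Fin 8)} (h : IsEquivalencePerm π) :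
    IsEquivalencePerm π.symm := by
  obtain ⟨P, Q, h⟩ := h
  have dirMatrix_one : (dirMatrix 1).map (Int.cast : ℤ → ℝ) = 1 := by
    rw [show dirMatrix 1 = 1 by decide, Matrix.map_one _ Int.cast_zero Int.cast_one]
  set B := (dirMatrix (π.symm 1)).map (Int.cast : ℤ → ℝ)
  have hPQ : P * B * Q = 1 := by rw [← h, π.apply_symm_apply, dirMatrix_one]
  have left_inv : B * Q * P = 1 := mul_eq_one_comm.1 (by rwa [← Matrix.mul_assoc])
  have right_inv : Q * (P * B) = 1 := mul_eq_one_comm.1 hPQ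
  refine ⟨B * Q, P * B, fun i => ?_⟩
  have hi := h (π.symm i)
  rw [π.apply_symm_apply] at hi
  rw [hi]
  calc (dirMatrix (π.symm i)).map (Int.cast : ℤ → ℝ)
      = (B * Q * P) * (dirMatrix (π.symm i)).map (Int.cast : ℤ → ℝ) * (Q * (P * B)) := by
        rw [left_inv, right_inv, Matrix.one_mul, Matrix.mul_one]
    _ = _ := by simp only [Matrix.mul_assoc]

theorem DirectionGraph.Equivalent.symm {V W : Type*} {Φ : DirectionGraph V}
    {Ψ : DirectionGraph W} (h : Φ.Equivalent Ψ) : Ψ.Equivalent Φ := by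
  obtain ⟨π, hπ, τ, h⟩ := h
  exact ⟨π.symm, hπ.symm, τ.symm, fun x y i => by
    rw [h, τ.apply_symm_apply, τ.apply_symm_apply, π.apply_symm_apply]⟩

theorem DirectionGraph.Equivalent.trans {U V W : Type*} {Φ : DirectionGraph U}
    {Ψ : DirectionGraph V} {Θ : DirectionGraph W} (h : Φ.Equivalent Ψ) (h' : Ψ.Equivalent Θ) :
    Φ.Equivalent Θ := by
  obtain ⟨π, hπ, τ, h⟩ := h
  obtain ⟨ρ, hρ, υ, h'⟩ := h'
  exact ⟨π.trans ρ, hπ.trans hρ, τ.trans υ, fun x y i => (h x y i).trans (h' _ _ _)⟩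

theorem IsFundamental.equivalent {V W : Type*} {e : List Letter} {o : Letter}
    (ho : o = .g ∨ o = .h) {Φ : DirectionGraph V} {Ψ : DirectionGraph W}
    (h : IsFundamental (flip e) Φ) (h' : IsSecondFundamental e o Ψ) : Φ.Equivalent Ψ := by
  obtain ⟨⟨f, hf⟩, noBacktrack⟩ := h.exists_isTraversal
  obtain ⟨⟨g, hg⟩, noBacktrack'⟩ := h'.exists_isTraversal ho
  refine hf.equivalent hg (isEquivalencePerm_starPerm_trans_originPerm ho) ?_
  have rotated := (isRotated_firstWord_secondWord e noBacktrack noBacktrack').map (originPerm o)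
  rwa [List.map_map] at rotated

end Equivalence

end Leaper

/-- If the strings `e'` and `e''` are flips of each other, then the fundamental direction cycle of
descent `e'` and the second fundamental direction cycles of descent `e''` and origins `g` and `h`
exist, and they are equivalent, whichever cycles they are extracted from. -/
theorem mainTheorem6 (e' e'' : List Leaper.Letter) (hflip : e' = Leaper.flip e'') :
    (∃ (V : Type) (Φ : Leaper.DirectionGraph V), Leaper.IsFundamental e' Φ) ∧
    (∃ (V : Type) (Φ : Leaper.DirectionGraph V), Leaper.IsSecondFundamental e'' .g Φ) ∧
    (∃ (V : Type) (Φ : Leaper.DirectionGraph V), Leaper.IsSecondFundamental e'' .h Φ) ∧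
    ∀ {V V₁ V₂ : Type*} (Φ : Leaper.DirectionGraph V)
      (Φg : Leaper.DirectionGraph V₁) (Φh : Leaper.DirectionGraph V₂),
      Leaper.IsFundamental e' Φ →
      Leaper.IsSecondFundamental e'' .g Φg →
      Leaper.IsSecondFundamental e'' .h Φh →
      Φ.Equivalent Φg ∧ Φ.Equivalent Φh ∧ Φg.Equivalent Φh := by
  subst hflip
  refine ⟨Leaper.exists_isFundamental _, Leaper.exists_isSecondFundamental _ (.inl rfl),
    Leaper.exists_isSecondFundamental _ (.inr rfl), fun Φ Φg Φh hΦ hg hh => ?_⟩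
  have equiv_g : Φ.Equivalent Φg := hΦ.equivalent (.inl rfl) hg
  have equiv_h : Φ.Equivalent Φh := hΦ.equivalent (.inr rfl) hh
  exact ⟨equiv_g, equiv_h, equiv_g.symm.trans equiv_h⟩
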